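/- Let $H^1(\mathbb{R}^3)$ be the Sobolev space of real-valued $u\in L^2(\mathbb{R}^3)$ with weak gradient $\nabla u\in L^2(\mathbb{R}^3)$, and let $H^1_r(\mathbb{R}^3)$ be its subspace of radial functions. Let $p\in(2,3)$ and, for $\lambda\in\mathbb{R}$ and $u\in H^1(\mathbb{R}^3)$, put $$I_\lambda(u)=\frac12\int_{\mathbb{R}^3}\left(|\nabla u|^2+u^2\right)dx+\frac{\lambda}{4}\int_{\mathbb{R}^3}\int_{\mathbb{R}^3}\frac{u^2(x)\,u^2(y)}{|x-y|}\,dx\,dy-\frac1p\int_{\mathbb{R}^3}|u|^p\,dx .$$ All these integrals are finite for every $u\in H^1(\mathbb{R}^3)$, so that $I_\lambda:H^1(\mathbb{R}^3)\to\mathbb{R}$ is well defined. There exists $\lambda_0>0$ (depending on $p$) such that $$\inf_{u\in H^1(\mathbb{R}^3)}I_\lambda(u)=0\ \text{ for every }\lambda\ge\lambda_0,\qquad \inf_{u\in H^1(\mathbb{R}^3)}I_\lambda(u)=-\infty\ \text{ for every }\lambda<\lambda_0 .$$ In contrast, for every $\lambda>0$ the restriction of $I_\lambda$ to $H^1_r(\mathbb{R}^3)$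 is bounded below. -/

import Mathlib

open MeasureTheory
open scoped ContDiff

noncomputable section

namespace SchrodingerPoissonSlater

/-- Three-dimensional Euclidean space. -/
abbrev R3 : Type := EuclideanSpace ℝ (Fin 3)

/-- `G` is a square integrable weak gradient of `u`: integration by parts holds against every
smooth compactly supported test function. -/
structure HasL2WeakGradient (u : R3 → ℝ) (G : R3 → R3) : Prop where
  memLp : MemLp G 2 volume
  integral_eq : ∀ φ : R3 → ℝ, ContDiff ℝ ∞ φ → HasCompactSupport φ → ∀ i : Fin 3,
    (∫ x, u x * fderiv ℝ φ x (EuclideanSpace.single i 1)) = - (∫ x, G x i * φ x)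

/-- The Sobolev space `H¹(ℝ³)` of real functions (as a set of representatives). -/
def H1 : Set (R3 → ℝ) :=
  {u | MemLp u 2 volume ∧ ∃ G : R3 → R3, HasL2WeakGradient u G}

/-- The subspace of radial functions in `H¹(ℝ³)`. -/
def H1rad : Set (R3 → ℝ) :=
  {u | u ∈ H1 ∧ ∃ f : ℝ → ℝ, ∀ᵐ x ∂(volume : Measure R3), u x = f ‖x‖}

open Classical in
/-- The weak gradient of `u` (only meaningful on `H1`, where it is unique up to null sets by
`HasL2WeakGradient.ae_eq`). -/
def weakGradient (u : R3 → ℝ) : R3 → R3 :=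
  if h : ∃ G : R3 → R3, HasL2WeakGradient u G then h.choose else 0

theorem hasL2WeakGradient_weakGradient {u : R3 → ℝ} (hu : u ∈ H1) :
    HasL2WeakGradient u (weakGradient u) := by
  unfold weakGradient
  rw [dif_pos hu.2]
  exact hu.2.choose_spec

theorem HasL2WeakGradient.ae_eq {u : R3 → ℝ} {G G' : R3 → R3}
    (h : HasL2WeakGradient u G) (h' : HasL2WeakGradient u G') : G =ᵐ[volume] G' := by
  have loc : ∀ {G : R3 → R3}, MemLp G 2 volume → ∀ i : Fin 3,
      LocallyIntegrable (fun x => G x i) volume := fun hG i =>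
    ((EuclideanSpace.proj (𝕜 := ℝ) i).comp_memLp' hG).locallyIntegrable (by norm_num)
  have key : ∀ i : Fin 3, ∀ᵐ x ∂(volume : Measure R3), G x i - G' x i = 0 := by
    intro i
    refine ae_eq_zero_of_integral_contDiff_smul_eq_zero
      ((loc h.memLp i).sub (loc h'.memLp i)) ?_
    intro φ hφ hc
    have i1 : Integrable (fun x => φ x * G x i) :=
      (loc h.memLp i).integrable_smul_left_of_hasCompactSupport hφ.continuous hc
    have i2 : Integrable (fun x => φ x * G' x i) :=
      (loc h'.memLp i).integrable_smul_left_of_hasCompactSupport hφ.continuous hc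
    have e := (h.integral_eq φ hφ hc i).symm.trans (h'.integral_eq φ hφ hc i)
    simp only [smul_eq_mul, mul_sub]
    rw [integral_sub i1 i2]
    simp only [mul_comm (φ _)]
    linarith
  filter_upwards [ae_all_iff.2 key] with x hx
  ext i
  linarith [hx i]

/-- The Coulomb integrand `u(x)² u(y)² / |x - y|`. -/
def coulombIntegrand (u : R3 → ℝ) (x y : R3) : ℝ :=
  u x ^ 2 * u y ^ 2 / ‖x - y‖

/-- The energy functional `I_λ`, with parameters `p` and `lam = λ`. -/
def energy (p lam : ℝ) (u : R3 → ℝ) : ℝ :=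
  (1 / 2) * (∫ x, (‖weakGradient u x‖ ^ 2 + u x ^ 2))
    + (lam / 4) * (∫ x, ∫ y, coulombIntegrand u x y)
    - (1 / p) * (∫ x, |u x| ^ p)

end SchrodingerPoissonSlater

end

/-! Write `A` for the integral of `|∇u|²`, `B` for that of `u²`, `D` for the Coulomb double
integral. For fixed `u` the energy is affine in `λ` with slope `D / 4 ≥ 0`. Hence the set `Λ` of
those `λ` for which the energy is nonnegative on all of `H¹` is closed and upward closed, and `λ₀`
is its infimum. Three facts give the dichotomy.

`Λ` is nonempty. The key inequality `exists_integral_cube_le` reads `∫ |u|³ ≤ C (s A + s⁻¹ D)` for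
every `s > 0`. It comes from `|u| ≤ C |∇u| * |x|⁻²`: after multiplying by `u²` and integrating,
Cauchy–Schwarz leaves the `L²` norm of `u² * |x|⁻²`, whose square is controlled by `D` because
`|x|⁻² * |x|⁻²` is dominated by a multiple of `|x|⁻¹`. Since `t ^ p ≤ t² + t³`, a large `λ` absorbs
the power term.

`0` is not in `Λ`. Without the Coulomb term, a large multiple of a bump has negative energy because
`p > 2`.

A negative value forces infimum `-∞`. The sum of two distant copies of a test function of negative
energy has nearly twice its energy, since only the Coulomb interaction is nonlocal and it decays
with the distance. Iterating drives the energy to `-∞` (`exists_energy_le_of_neg`,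
`iInf_energy_eq_bot`).

For radial functions copies cannot be moved apart. The power term is absorbed by `B`, by `A` and `D`
through the cubic inequality, and by a multiple of the measure of `S = {|u| ≥ α}`. Strauss decay
puts `S` in a ball whose radius is of order `√(A + B)`, so `D` controls `|S|²` divided by that
radius. The remaining loss is only of order `√(A + B)`, and `(A + B) / 4` compensates for it.

All estimates are made for test functions. They pass to `H¹` by mollification and cutoff, which
preserve radiality, and by convergence of the energy along the approximating sequence
(`exists_smooth_tendsto_energy`). -/

open MeasureTheory
open scoped ContDiff

noncomputable section

namespace SchrodingerPoissonSlater

open Set Filter Topology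
open scoped ENNReal

/-! ### Integrals of powers of the norm and the composition of `|x|⁻²` with itself. -/

/-- The area of the unit sphere of `ℝ³`. -/
def sphereArea : ℝ := 3 * (volume : Measure R3).real (Metric.ball 0 1)

theorem sphereArea_pos : 0 < sphereArea := by
  have : 0 < (volume : Measure R3).real (Metric.ball 0 1) :=
    ENNReal.toReal_pos (Metric.measure_ball_pos _ _ one_pos).ne' measure_ball_lt_top.ne
  unfold sphereArea
  positivity

theorem lintegral_fun_norm {f : ℝ → ℝ} (h0 : ∀ s, 0 ≤ f s)
    (hf : IntegrableOn (fun s => s ^ 2 * f s) (Ioi 0)) :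
    ∫⁻ x : R3, ENNReal.ofReal (f ‖x‖)
      = ENNReal.ofReal (sphereArea * ∫ s in Ioi (0 : ℝ), s ^ 2 * f s) := by
  have hi : Integrable (fun x : R3 => f ‖x‖) := by
    rw [integrable_fun_norm_addHaar (volume : Measure R3)]
    simpa using hf
  rw [← ofReal_integral_eq_lintegral_ofReal hi (ae_of_all _ fun x => h0 _),
    integral_fun_norm_addHaar (volume : Measure R3)]
  simp [sphereArea, mul_assoc]

theorem lintegral_ball_norm_inv_sq {r : ℝ} (hr : 0 < r) :
    ∫⁻ x : R3, ENNReal.ofReal ((Iio r).indicator (fun s => (s ^ 2)⁻¹) ‖x‖)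
      = ENNReal.ofReal (sphereArea * r) := by
  have e : ∀ s ∈ Ioi (0 : ℝ), s ^ 2 * (Iio r).indicator (fun s => (s ^ 2)⁻¹) s
      = (Iio r).indicator (fun _ => (1 : ℝ)) s := by
    intro s hs
    have : s ≠ 0 := (mem_Ioi.1 hs).ne'
    by_cases h : s < r <;> simp [h, this]
  rw [lintegral_fun_norm]
  · rw [setIntegral_congr_fun measurableSet_Ioi e, setIntegral_indicator measurableSet_Iio]
    simp [Ioi_inter_Iio, hr.le]
  · intro s
    exact indicator_nonneg (fun _ _ => by positivity) _
  · rw [integrableOn_congr_fun e measurableSet_Ioi, IntegrableOn,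
      integrable_indicator_iff measurableSet_Iio, IntegrableOn, Measure.restrict_restrict
      measurableSet_Iio]
    simp [Iio_inter_Ioi]

theorem lintegral_compl_ball_norm_inv_pow_four {r : ℝ} (hr : 0 < r) :
    ∫⁻ x : R3, ENNReal.ofReal ((Ici r).indicator (fun s => (s ^ 4)⁻¹) ‖x‖)
      = ENNReal.ofReal (sphereArea * r⁻¹) := by
  have e : ∀ s ∈ Ioi (0 : ℝ), s ^ 2 * (Ici r).indicator (fun s => (s ^ 4)⁻¹) s
      = (Ici r).indicator (fun s => s ^ (-2 : ℝ)) s := by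
    intro s hs
    have : s ≠ 0 := (mem_Ioi.1 hs).ne'
    by_cases h : r ≤ s
    · have h2 : s ^ (-2 : ℝ) = (s ^ 2)⁻¹ := by
        rw [Real.rpow_neg (mem_Ioi.1 hs).le]; norm_cast
      simp only [mem_Ici, h, indicator_of_mem, h2]
      field_simp
    · simp [h]
  have es : Ici r ∩ Ioi 0 = Ici r := inter_eq_left.2 fun s hs => hr.trans_le hs
  rw [lintegral_fun_norm]
  · rw [setIntegral_congr_fun measurableSet_Ioi e, setIntegral_indicator measurableSet_Ici,
      inter_comm, es, integral_Ici_eq_integral_Ioi, integral_Ioi_rpow_of_lt (by norm_num) hr]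
    norm_num [Real.rpow_neg_one]
  · intro s
    exact indicator_nonneg (fun _ _ => by positivity) _
  · rw [integrableOn_congr_fun e measurableSet_Ioi, IntegrableOn,
      integrable_indicator_iff measurableSet_Ici, IntegrableOn, Measure.restrict_restrict
      measurableSet_Ici, es]
    exact (integrableOn_Ici_iff_integrableOn_Ioi (by simp)).2
      (integrableOn_Ioi_rpow_of_lt (by norm_num) hr)

/-- The kernel `|x|⁻²` composed with itself is dominated by the Coulomb kernel. -/
theorem lintegral_inv_sq_mul_inv_sq_le {x z : R3} (hxz : x ≠ z) :
    ∫⁻ y : R3, ENNReal.ofReal ((‖x - y‖ ^ 2)⁻¹ * (‖z - y‖ ^ 2)⁻¹)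
      ≤ ENNReal.ofReal (8 * sphereArea / ‖x - z‖) := by
  set d := ‖x - z‖ with hd
  have hd0 : 0 < d := norm_pos_iff.2 (sub_ne_zero.2 hxz)
  -- Within `d / 2` of one point the other factor is at most `4 / d²`, and away from both points `a
  -- b ≤ a² + b²` gives fourth powers. Each of `(4 / d²) h1` and `h2` has integral `2 * sphereArea /
  -- d`, and both occur around `x` and around `z`, whence the constant `8`.
  set h1 : R3 → ℝ := fun w => (Iio (d / 2)).indicator (fun s => (s ^ 2)⁻¹) ‖w‖ with hh1
  set h2 : R3 → ℝ := fun w => (Ici (d / 2)).indicator (fun s => (s ^ 4)⁻¹) ‖w‖ with hh2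
  have m1 : Measurable h1 :=
    (Measurable.indicator (by fun_prop) measurableSet_Iio).comp measurable_norm
  have m2 : Measurable h2 :=
    (Measurable.indicator (by fun_prop) measurableSet_Ici).comp measurable_norm
  set h : R3 → ℝ≥0∞ := fun w =>
    ENNReal.ofReal (4 / d ^ 2) * ENNReal.ofReal (h1 w) + ENNReal.ofReal (h2 w) with hh
  have hint : ∫⁻ w, h w = ENNReal.ofReal (4 * sphereArea / d) := by
    rw [hh, lintegral_add_right _ m2.ennreal_ofReal, lintegral_const_mul _ m1.ennreal_ofReal,
      lintegral_ball_norm_inv_sq (half_pos hd0),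
      lintegral_compl_ball_norm_inv_pow_four (half_pos hd0),
      ← ENNReal.ofReal_mul (by positivity), ← ENNReal.ofReal_add]
    · congr 1
      field_simp
      ring
    · have := sphereArea_pos; positivity
    · have := sphereArea_pos; positivity
  have hs : ∀ a : R3, ∫⁻ y, h (a - y) = ENNReal.ofReal (4 * sphereArea / d) := fun a => by
    rw [lintegral_sub_left_eq_self h a, hint]
  have n1 : ∀ w, 0 ≤ h1 w := fun w => indicator_nonneg (fun _ _ => by positivity) _
  have n2 : ∀ w, 0 ≤ h2 w := fun w => indicator_nonneg (fun _ _ => by positivity) _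
  have hm : Measurable h := by fun_prop
  have hreal : ∀ w, h w = ENNReal.ofReal (4 / d ^ 2 * h1 w + h2 w) := fun w => by
    rw [hh, ENNReal.ofReal_add (mul_nonneg (by positivity) (n1 w)) (n2 w),
      ENNReal.ofReal_mul (by positivity)]
  have near : ∀ a b : ℝ, 0 ≤ a → d / 2 ≤ b → (a ^ 2)⁻¹ * (b ^ 2)⁻¹ ≤ 4 / d ^ 2 * (a ^ 2)⁻¹ := by
    intro a b ha hb
    rw [mul_comm]
    gcongr
    rw [show 4 / d ^ 2 = ((d / 2) ^ 2)⁻¹ by field_simp; norm_num]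
    gcongr
  have key : ∀ y, ENNReal.ofReal ((‖x - y‖ ^ 2)⁻¹ * (‖z - y‖ ^ 2)⁻¹) ≤ h (x - y) + h (z - y) := by
    intro y
    have tri : d ≤ ‖x - y‖ + ‖z - y‖ := by
      rw [hd, norm_sub_rev z y]
      exact norm_sub_le_norm_sub_add_norm_sub x y z
    have p1 := mul_nonneg (by positivity : 0 ≤ 4 / d ^ 2) (n1 (x - y))
    have p2 := mul_nonneg (by positivity : 0 ≤ 4 / d ^ 2) (n1 (z - y))
    have p3 := n2 (x - y)
    have p4 := n2 (z - y)
    rw [hreal, hreal, ← ENNReal.ofReal_add (by positivity) (by positivity)]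
    apply ENNReal.ofReal_le_ofReal
    by_cases c1 : ‖x - y‖ < d / 2
    · have := near ‖x - y‖ ‖z - y‖ (norm_nonneg _) (by linarith)
      have e : h1 (x - y) = (‖x - y‖ ^ 2)⁻¹ := by simp [hh1, c1]
      rw [e] at p1 ⊢
      linarith
    by_cases c2 : ‖z - y‖ < d / 2
    · have := near ‖z - y‖ ‖x - y‖ (norm_nonneg _) (by linarith)
      have e : h1 (z - y) = (‖z - y‖ ^ 2)⁻¹ := by simp [hh1, c2]
      rw [e] at p2 ⊢
      linarith
    have e1 : h2 (x - y) = ((‖x - y‖ ^ 2)⁻¹) ^ 2 := by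
      simp only [hh2, mem_Ici, not_lt.1 c1, indicator_of_mem]
      rw [← inv_pow, ← inv_pow, ← pow_mul]
    have e2 : h2 (z - y) = ((‖z - y‖ ^ 2)⁻¹) ^ 2 := by
      simp only [hh2, mem_Ici, not_lt.1 c2, indicator_of_mem]
      rw [← inv_pow, ← inv_pow, ← pow_mul]
    rw [e1, e2]
    nlinarith [sq_nonneg ((‖x - y‖ ^ 2)⁻¹ - (‖z - y‖ ^ 2)⁻¹), sq_nonneg ((‖x - y‖ ^ 2)⁻¹),
      sq_nonneg ((‖z - y‖ ^ 2)⁻¹)]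
  calc _ ≤ ∫⁻ y, (h (x - y) + h (z - y)) := lintegral_mono key
    _ = ENNReal.ofReal (4 * sphereArea / d) + ENNReal.ofReal (4 * sphereArea / d) := by
      rw [lintegral_add_left (by fun_prop), hs, hs]
    _ = _ := by
      have := sphereArea_pos
      rw [← ENNReal.ofReal_add (by positivity) (by positivity)]
      congr 1
      ring

theorem lintegral_comp_pos_smul {F : R3 → ℝ≥0∞} (hF : Measurable F) {t : ℝ} (ht : 0 < t) :
    ∫⁻ z, F (t • z) = ENNReal.ofReal ((t ^ 3)⁻¹) * ∫⁻ w, F w := by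
  have := Measure.map_addHaar_smul (volume : Measure R3) ht.ne'
  rw [← lintegral_map hF (measurable_const_smul t), this, lintegral_smul_measure]
  simp [abs_of_pos ht]

/-! ### Pointwise bound of a function by the Riesz potential of its gradient. -/

/-- A compactly supported function is controlled by its derivative along any ray. -/
theorem enorm_le_lintegral_ray {u : R3 → ℝ} (hu : ContDiff ℝ 1 u) (hc : HasCompactSupport u)
    (x : R3) {z : R3} (hz : z ≠ 0) :
    ‖u x‖ₑ ≤ ∫⁻ t in Ioi (0 : ℝ), ‖fderiv ℝ u (x + t • z)‖ₑ * ‖z‖ₑ := by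
  set g : ℝ → ℝ := fun t => u (x + t • z) with hg
  have hd : ∀ t, HasDerivAt g (fderiv ℝ u (x + t • z) z) t := by
    intro t
    have h1 : HasDerivAt (fun t : ℝ => x + t • z) z t := by
      simpa using ((hasDerivAt_id t).smul_const z).const_add x
    exact ((hu.differentiable one_ne_zero _).hasFDerivAt).comp_hasDerivAt t h1
  have hcont : Continuous fun t : ℝ => fderiv ℝ u (x + t • z) z := by
    have := hu.continuous_fderiv one_ne_zero
    fun_prop
  obtain ⟨R, hR⟩ := hc.isCompact.isBounded.subset_closedBall (0 : R3)
  have hout : ∀ y : R3, R < ‖y‖ → u y = 0 := fun y hy => by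
    by_contra h
    have := hR (subset_tsupport _ h)
    simp at this
    linarith
  obtain ⟨T, hT0, hT⟩ : ∃ T : ℝ, 0 ≤ T ∧ g T = 0 := by
    -- At this time the ray has travelled `|R| + ‖x‖ + 1`, hence has left the ball containing the
    -- support. The absolute value is there because `R` may be negative.
    refine ⟨(|R| + ‖x‖ + 1) / ‖z‖, by positivity, hout _ ?_⟩
    have hz' : 0 < ‖z‖ := norm_pos_iff.2 hz
    have h1 : ‖((|R| + ‖x‖ + 1) / ‖z‖) • z‖ = |R| + ‖x‖ + 1 := by
      rw [norm_smul, Real.norm_of_nonneg (by positivity), div_mul_cancel₀ _ hz'.ne']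
    have h2 := norm_sub_le_norm_add (((|R| + ‖x‖ + 1) / ‖z‖) • z) x
    rw [h1, add_comm (_ • z)] at h2
    linarith [le_abs_self R]
  have hftc : ∫ t in (0 : ℝ)..T, fderiv ℝ u (x + t • z) z = g T - g 0 :=
    intervalIntegral.integral_eq_sub_of_hasDerivAt (fun t _ => hd t)
      (hcont.intervalIntegrable _ _)
  have hux : u x = - ∫ t in (0 : ℝ)..T, fderiv ℝ u (x + t • z) z := by
    rw [hftc, hT]; simp [hg]
  rw [hux, enorm_neg, intervalIntegral.integral_of_le hT0]
  calc _ ≤ ∫⁻ t in Ioc 0 T, ‖fderiv ℝ u (x + t • z) z‖ₑ := enorm_integral_le_lintegral_enorm _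
    _ ≤ ∫⁻ t in Ioi (0 : ℝ), ‖fderiv ℝ u (x + t • z) z‖ₑ :=
      lintegral_mono_set Ioc_subset_Ioi_self
    _ ≤ _ := lintegral_mono fun t => ContinuousLinearMap.le_opENorm _ _

/-- The spherical shell `1 ≤ |z| < 2`. -/
def shell : Set R3 := {z | 1 ≤ ‖z‖ ∧ ‖z‖ < 2}

theorem measurableSet_shell : MeasurableSet shell :=
  (measurableSet_le measurable_const measurable_norm).inter
    (measurableSet_lt measurable_norm measurable_const)

theorem volume_shell_ne_top : volume shell ≠ ⊤ := by
  refine ((measure_mono fun z hz => ?_).trans_lt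
    (measure_ball_lt_top (x := (0 : R3)) (r := 2))).ne
  simpa using hz.2

theorem volume_shell_ne_zero : volume shell ≠ 0 := by
  have ho : IsOpen {z : R3 | 1 < ‖z‖ ∧ ‖z‖ < 2} :=
    (isOpen_lt continuous_const continuous_norm).inter
      (isOpen_lt continuous_norm continuous_const)
  have hne : {z : R3 | 1 < ‖z‖ ∧ ‖z‖ < 2}.Nonempty := by
    refine ⟨EuclideanSpace.single 0 (3 / 2), ?_⟩
    norm_num [PiLp.norm_single, abs_of_pos]
  exact ((ho.measure_pos volume hne).trans_le
    (measure_mono (t := shell) fun z hz => ⟨hz.1.le, hz.2⟩)).ne'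

/-- The point `t⁻¹ • w` lies in the shell exactly for `‖w‖ / 2 < t ≤ ‖w‖`. This interval has length
`‖w‖ / 2` and `t⁻³ ≤ 8 ‖w‖⁻³` on it. -/
theorem lintegral_shell_scale_le (w : R3) :
    ∫⁻ t in Ioi (0 : ℝ), ENNReal.ofReal ((t ^ 3)⁻¹) * shell.indicator 1 (t⁻¹ • w)
      ≤ ENNReal.ofReal (4 * (‖w‖ ^ 2)⁻¹) := by
  rcases eq_or_ne w 0 with rfl | hw
  · have : (0 : R3) ∉ shell := by simp [shell]
    simp [this]
  have hw' : 0 < ‖w‖ := norm_pos_iff.2 hw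
  calc _ ≤ ∫⁻ t in Ioi (0 : ℝ), (Ioc (‖w‖ / 2) ‖w‖).indicator
        (fun _ => ENNReal.ofReal (8 * (‖w‖ ^ 3)⁻¹)) t := by
        refine setLIntegral_mono' measurableSet_Ioi fun t ht => ?_
        have ht' : 0 < t := ht
        by_cases hs : t⁻¹ • w ∈ shell
        · obtain ⟨h1, h2⟩ := hs
          rw [norm_smul, norm_inv, Real.norm_of_nonneg ht'.le, inv_mul_eq_div] at h1 h2
          rw [one_le_div ht'] at h1
          rw [div_lt_iff₀ ht'] at h2
          have hm : t ∈ Ioc (‖w‖ / 2) ‖w‖ := ⟨by linarith, h1⟩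
          rw [indicator_of_mem hm]
          have h3 : shell.indicator (1 : R3 → ℝ≥0∞) (t⁻¹ • w) ≤ 1 :=
            indicator_le_self' (by simp) _
          refine (mul_le_of_le_one_right' h3).trans (ENNReal.ofReal_le_ofReal ?_)
          rw [show 8 * (‖w‖ ^ 3)⁻¹ = ((‖w‖ / 2) ^ 3)⁻¹ by field_simp; norm_num]
          have := hm.1.le
          gcongr
        · simp [hs]
    _ ≤ ∫⁻ t, (Ioc (‖w‖ / 2) ‖w‖).indicator
        (fun _ => ENNReal.ofReal (8 * (‖w‖ ^ 3)⁻¹)) t := setLIntegral_le_lintegral _ _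
    _ = ENNReal.ofReal (8 * (‖w‖ ^ 3)⁻¹) * ENNReal.ofReal (‖w‖ - ‖w‖ / 2) := by
        rw [lintegral_indicator_const measurableSet_Ioc, Real.volume_Ioc]
    _ = _ := by
        rw [← ENNReal.ofReal_mul (by positivity)]
        congr 1
        field_simp
        ring

/-- A compactly supported `C¹` function is dominated by the Riesz potential of its gradient. -/
theorem volume_shell_mul_enorm_le {u : R3 → ℝ} (hu : ContDiff ℝ 1 u) (hc : HasCompactSupport u)
    (x : R3) :
    volume shell * ‖u x‖ₑ
      ≤ 8 * ∫⁻ y, ‖fderiv ℝ u y‖ₑ * ENNReal.ofReal ((‖x - y‖ ^ 2)⁻¹) := by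
  set g : R3 → ℝ≥0∞ := fun y => ‖fderiv ℝ u y‖ₑ with hg
  have hgm : Measurable g := (hu.continuous_fderiv one_ne_zero).measurable.enorm
  have hS : Measurable (shell.indicator (1 : R3 → ℝ≥0∞)) :=
    measurable_one.indicator measurableSet_shell
  calc volume shell * ‖u x‖ₑ = ∫⁻ z, shell.indicator 1 z * ‖u x‖ₑ := by
        rw [lintegral_mul_const _ hS, lintegral_indicator_one measurableSet_shell]
    -- The ray bound is averaged over directions in a solid shell, so that no surface measure is
    -- needed. The factor `2` bounds `‖z‖`.
    _ ≤ ∫⁻ z, ∫⁻ t in Ioi (0 : ℝ), shell.indicator 1 z * (g (x + t • z) * 2) := by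
        refine lintegral_mono fun z => ?_
        rw [lintegral_const_mul _ (by fun_prop)]
        by_cases hz : z ∈ shell
        · have hz0 : z ≠ 0 := by
            rintro rfl
            norm_num [shell] at hz
          simp only [hz, indicator_of_mem, Pi.one_apply, one_mul]
          refine (enorm_le_lintegral_ray hu hc x hz0).trans (lintegral_mono fun t => ?_)
          simp only [hg]
          gcongr
          rw [← ofReal_norm]
          exact (ENNReal.ofReal_le_ofReal hz.2.le).trans (by simp)
        · simp [hz]
    _ = ∫⁻ t in Ioi (0 : ℝ), ∫⁻ z, shell.indicator 1 z * (g (x + t • z) * 2) := by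
        refine lintegral_lintegral_swap (Measurable.aemeasurable ?_)
        have : Measurable fun z : R3 × ℝ => shell.indicator (1 : R3 → ℝ≥0∞) z.1 :=
          hS.comp measurable_fst
        simp only [Function.uncurry_def]
        refine Measurable.mul this ?_
        fun_prop
    -- The substitution `w = t • z` has Jacobian `t⁻³`; once `w` is outermost, the integral over `t`
    -- produces the kernel `‖w‖⁻²`.
    _ = ∫⁻ t in Ioi (0 : ℝ), ∫⁻ w, ENNReal.ofReal ((t ^ 3)⁻¹) *
          (shell.indicator 1 (t⁻¹ • w) * (g (x + w) * 2)) := by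
        refine setLIntegral_congr_fun measurableSet_Ioi fun t ht => ?_
        have ht' : (0 : ℝ) < t := ht
        have hm : Measurable fun w => shell.indicator 1 (t⁻¹ • w) * (g (x + w) * 2) :=
          (hS.comp (measurable_const_smul t⁻¹)).mul (by fun_prop)
        rw [lintegral_const_mul _ hm, ← lintegral_comp_pos_smul hm ht']
        simp [smul_smul, ht'.ne']
    _ = ∫⁻ w, ∫⁻ t in Ioi (0 : ℝ), ENNReal.ofReal ((t ^ 3)⁻¹) *
          (shell.indicator 1 (t⁻¹ • w) * (g (x + w) * 2)) := by
        rw [lintegral_lintegral_swap]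
        refine Measurable.aemeasurable ?_
        have : Measurable fun z : ℝ × R3 => shell.indicator (1 : R3 → ℝ≥0∞) (z.1⁻¹ • z.2) :=
          hS.comp (by fun_prop)
        simp only [Function.uncurry_def]
        fun_prop
    _ ≤ ∫⁻ w, ENNReal.ofReal (4 * (‖w‖ ^ 2)⁻¹) * (g (x + w) * 2) := by
        refine lintegral_mono fun w => ?_
        simp only [← mul_assoc _ _ (g (x + w) * 2)]
        have : Measurable fun t : ℝ => shell.indicator (1 : R3 → ℝ≥0∞) (t⁻¹ • w) :=
          hS.comp (by fun_prop)
        rw [lintegral_mul_const _ (by fun_prop)]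
        gcongr
        exact lintegral_shell_scale_le w
    _ = ∫⁻ w, 8 * (g (w + x) * ENNReal.ofReal ((‖x - (w + x)‖ ^ 2)⁻¹)) := by
        refine lintegral_congr fun w => ?_
        rw [ENNReal.ofReal_mul (by norm_num), add_comm x w, sub_add_cancel_right, norm_neg]
        norm_num
        ring
    _ = ∫⁻ y, 8 * (g y * ENNReal.ofReal ((‖x - y‖ ^ 2)⁻¹)) :=
        lintegral_add_right_eq_self
          (fun y => 8 * (g y * ENNReal.ofReal ((‖x - y‖ ^ 2)⁻¹))) x
    _ = _ := lintegral_const_mul _ (by fun_prop)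

/-! ### The cubic integral against the gradient and the Coulomb energy. -/

theorem mul_le_ofReal_mul_sq_add {a b : ℝ≥0∞} {s : ℝ} (hs : 0 < s) :
    a * b ≤ ENNReal.ofReal s * a ^ 2 + ENNReal.ofReal s⁻¹ * b ^ 2 := by
  rcases le_total b (ENNReal.ofReal s * a) with h | h
  · refine le_add_right ?_
    calc a * b ≤ a * (ENNReal.ofReal s * a) := by gcongr
      _ = _ := by ring
  · refine le_add_left ?_
    have h' : a ≤ ENNReal.ofReal s⁻¹ * b := by
      rw [ENNReal.ofReal_inv_of_pos hs]
      rwa [← ENNReal.mul_le_iff_le_inv (by simpa using hs) ENNReal.ofReal_ne_top]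
    calc a * b ≤ ENNReal.ofReal s⁻¹ * b * b := by gcongr
      _ = _ := by ring

/-- One factor of `|u|³ = u² |u|` is replaced by its Riesz potential, and Tonelli turns the result
into the integral of `|∇u|` against `F = u² * |x|⁻²`. Weighted Young splits this product. Expanding
`F²` as a double integral, the `y`-integral of the two kernels is bounded by the Coulomb kernel.
Keeping `s` free carries the same information as the product form of Cauchy–Schwarz. -/
theorem volume_shell_mul_lintegral_cube_le {u : R3 → ℝ} (hu : ContDiff ℝ 1 u)
    (hc : HasCompactSupport u) {s : ℝ} (hs : 0 < s) :
    volume shell * ∫⁻ x, ‖u x‖ₑ ^ 3 ≤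
      8 * (ENNReal.ofReal s * (∫⁻ y, ‖fderiv ℝ u y‖ₑ ^ 2) + ENNReal.ofReal s⁻¹ *
        ∫⁻ x, ∫⁻ z, ‖u x‖ₑ ^ 2 * ‖u z‖ₑ ^ 2 * ENNReal.ofReal (8 * sphereArea / ‖x - z‖)) := by
  set g : R3 → ℝ≥0∞ := fun y => ‖fderiv ℝ u y‖ₑ with hg
  have hgm : Measurable g := (hu.continuous_fderiv one_ne_zero).measurable.enorm
  set q : R3 → ℝ≥0∞ := fun y => ‖u y‖ₑ ^ 2 with hq
  have hqm : Measurable q := hu.continuous.measurable.enorm.pow_const 2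
  set k : R3 → ℝ≥0∞ := fun a => ENNReal.ofReal ((‖a‖ ^ 2)⁻¹) with hk
  have hkm : Measurable k := by fun_prop
  have hum : Measurable u := hu.continuous.measurable
  set F : R3 → ℝ≥0∞ := fun y => ∫⁻ x, q x * k (x - y) with hF
  have hFm : Measurable F :=
    Measurable.lintegral_prod_right' (f := fun z : R3 × R3 => q z.2 * k (z.2 - z.1))
      (by fun_prop)
  have hFF : ∫⁻ y, F y ^ 2 ≤
      ∫⁻ x, ∫⁻ z, q x * q z * ENNReal.ofReal (8 * sphereArea / ‖x - z‖) := by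
    calc ∫⁻ y, F y ^ 2 = ∫⁻ y, ∫⁻ x, ∫⁻ z, (q x * q z) * (k (x - y) * k (z - y)) := by
          refine lintegral_congr fun y => ?_
          rw [sq, hF]
          simp only
          rw [← lintegral_mul_const _ (by fun_prop)]
          refine lintegral_congr fun x => ?_
          rw [← lintegral_const_mul _ (by fun_prop)]
          refine lintegral_congr fun z => ?_
          ring
      _ = ∫⁻ x, ∫⁻ y, ∫⁻ z, (q x * q z) * (k (x - y) * k (z - y)) := by
          rw [lintegral_lintegral_swap]
          refine Measurable.aemeasurable ?_
          exact Measurable.lintegral_prod_right'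
            (f := fun a : (R3 × R3) × R3 =>
              (q a.1.2 * q a.2) * (k (a.1.2 - a.1.1) * k (a.2 - a.1.1))) (by fun_prop)
      _ = ∫⁻ x, ∫⁻ z, ∫⁻ y, (q x * q z) * (k (x - y) * k (z - y)) := by
          refine lintegral_congr fun x => ?_
          rw [lintegral_lintegral_swap]
          refine Measurable.aemeasurable ?_
          simp only [Function.uncurry_def]
          fun_prop
      _ ≤ _ := by
          refine lintegral_mono fun x => lintegral_mono_ae ?_
          filter_upwards [compl_mem_ae_iff.2 (measure_singleton x)] with z hz
          rw [lintegral_const_mul _ (by fun_prop)]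
          gcongr
          simp only [hk]
          simp only [← ENNReal.ofReal_mul (inv_nonneg.2 (sq_nonneg ‖x - _‖))]
          exact lintegral_inv_sq_mul_inv_sq_le (Ne.symm hz)
  calc volume shell * ∫⁻ x, ‖u x‖ₑ ^ 3 = ∫⁻ x, q x * (volume shell * ‖u x‖ₑ) := by
        rw [← lintegral_const_mul _ (by fun_prop)]
        refine lintegral_congr fun x => ?_
        simp only [hq]
        ring
    _ ≤ ∫⁻ x, q x * (8 * ∫⁻ y, g y * k (x - y)) :=
        lintegral_mono fun x => mul_le_mul_right (volume_shell_mul_enorm_le hu hc x) _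
    _ = 8 * ∫⁻ x, ∫⁻ y, g y * (q x * k (x - y)) := by
        rw [← lintegral_const_mul]
        · refine lintegral_congr fun x => ?_
          rw [mul_left_comm, ← lintegral_const_mul _ (by fun_prop)]
          congr 1
          refine lintegral_congr fun y => ?_
          ring
        · exact Measurable.lintegral_prod_right'
            (f := fun z : R3 × R3 => g z.2 * (q z.1 * k (z.1 - z.2))) (by fun_prop)
    _ = 8 * ∫⁻ y, g y * F y := by
        rw [lintegral_lintegral_swap]
        · congr 1
          refine lintegral_congr fun y => ?_
          rw [lintegral_const_mul _ (by fun_prop)]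
        · refine Measurable.aemeasurable ?_
          simp only [Function.uncurry_def]
          fun_prop
    _ ≤ 8 * ∫⁻ y, (ENNReal.ofReal s * g y ^ 2 + ENNReal.ofReal s⁻¹ * F y ^ 2) := by
        gcongr with y
        exact mul_le_ofReal_mul_sq_add hs
    _ = 8 * (ENNReal.ofReal s * (∫⁻ y, g y ^ 2) + ENNReal.ofReal s⁻¹ * ∫⁻ y, F y ^ 2) := by
        rw [lintegral_add_left (by fun_prop), lintegral_const_mul _ (by fun_prop),
          lintegral_const_mul _ (by fun_prop)]
    _ ≤ _ := by gcongr

/-! ### Finiteness and continuity of the Coulomb energy. -/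

/-- The Coulomb energy, as an integral over the product space. -/
def coulomb (u : R3 → ℝ) : ℝ :=
  ∫ z : R3 × R3, coulombIntegrand u z.1 z.2 ∂(volume.prod volume)

theorem coulomb_nonneg (u : R3 → ℝ) : 0 ≤ coulomb u :=
  integral_nonneg fun z => by unfold coulombIntegrand; positivity

/-- A uniform bound for the Coulomb potential of `w²`. -/
def potentialBound (w : R3 → ℝ) : ℝ := (∫ x, w x ^ 2) + (∫ x, w x ^ 4) + sphereArea

theorem potentialBound_nonneg (w : R3 → ℝ) : 0 ≤ potentialBound w := by
  have h2 : 0 ≤ ∫ x, w x ^ 2 := integral_nonneg fun x => by positivity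
  have h4 : 0 ≤ ∫ x, w x ^ 4 := integral_nonneg fun x => by positivity
  have := sphereArea_pos
  unfold potentialBound
  positivity

theorem integrable_pow_four {w : R3 → ℝ} (h4 : MemLp w 4 volume) :
    Integrable (fun x => w x ^ 4) := by
  have := h4.integrable_norm_pow (p := 4) (by norm_num)
  refine this.congr (ae_of_all _ fun x => ?_)
  simp [Even.pow_abs (by decide : Even 4)]

/-- For `‖x - y‖ < 1` one has `w² / ‖x - y‖ ≤ w⁴ + ‖x - y‖⁻²`, and the last kernel has integral
`sphereArea` over the unit ball. Elsewhere the integrand is at most `w²`. The bound is uniform in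
`x`, which makes the Coulomb form continuous in the `L¹` norm of its other argument. -/
theorem lintegral_potential_le {w : R3 → ℝ} (h2 : MemLp w 2 volume) (h4 : MemLp w 4 volume)
    (x : R3) :
    ∫⁻ y, ENNReal.ofReal (w y ^ 2 / ‖x - y‖) ≤ ENNReal.ofReal (potentialBound w) := by
  set k : R3 → ℝ := fun a => (Iio 1).indicator (fun s => (s ^ 2)⁻¹) ‖a‖ with hk
  have hkm : Measurable k :=
    (Measurable.indicator (by fun_prop) measurableSet_Iio).comp measurable_norm
  have hk0 : ∀ a, 0 ≤ k a := fun a => indicator_nonneg (fun _ _ => by positivity) _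
  have i2 := h2.integrable_sq
  have i4 := integrable_pow_four h4
  have hw : AEMeasurable w := h2.aestronglyMeasurable.aemeasurable
  calc _ ≤ ∫⁻ y, (ENNReal.ofReal (w y ^ 2) + ENNReal.ofReal (w y ^ 4)
        + ENNReal.ofReal (k (x - y))) := by
        refine lintegral_mono fun y => ?_
        rw [← ENNReal.ofReal_add (by positivity) (by positivity),
          ← ENNReal.ofReal_add (by positivity) (hk0 _)]
        apply ENNReal.ofReal_le_ofReal
        have h4' : 0 ≤ w y ^ 4 := by positivity
        by_cases c : ‖x - y‖ < 1
        · have e : k (x - y) = (‖x - y‖⁻¹) ^ 2 := by simp [hk, c]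
          rw [e, div_eq_mul_inv]
          nlinarith [sq_nonneg (w y ^ 2 - ‖x - y‖⁻¹), sq_nonneg (w y), sq_nonneg (‖x - y‖⁻¹)]
        · have h5 : w y ^ 2 / ‖x - y‖ ≤ w y ^ 2 := div_le_self (by positivity) (not_lt.1 c)
          linarith [hk0 (x - y)]
    _ = (∫⁻ y, ENNReal.ofReal (w y ^ 2)) + (∫⁻ y, ENNReal.ofReal (w y ^ 4))
        + ∫⁻ y, ENNReal.ofReal (k (x - y)) := by
        rw [lintegral_add_right _ (by fun_prop), lintegral_add_left' (by fun_prop)]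
    _ = _ := by
        rw [lintegral_sub_left_eq_self (fun a => ENNReal.ofReal (k a)) x, hk,
          lintegral_ball_norm_inv_sq one_pos,
          ← ofReal_integral_eq_lintegral_ofReal i2 (ae_of_all _ fun x => by positivity),
          ← ofReal_integral_eq_lintegral_ofReal i4 (ae_of_all _ fun x => by positivity),
          ← ENNReal.ofReal_add (integral_nonneg fun x => by positivity)
            (integral_nonneg fun x => by positivity),
          ← ENNReal.ofReal_add _ (by simpa using sphereArea_pos.le), mul_one, potentialBound]
        exact add_nonneg (integral_nonneg fun x => by positivity)
            (integral_nonneg fun x => by positivity)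

theorem aemeasurable_coulomb {f w : R3 → ℝ} (hf : AEStronglyMeasurable f volume)
    (hw : AEStronglyMeasurable w volume) :
    AEMeasurable (fun z : R3 × R3 => f z.1 * w z.2 ^ 2 / ‖z.1 - z.2‖)
      (volume.prod volume) := by
  have hw' : AEMeasurable (fun z : R3 × R3 => w z.2) (volume.prod volume) :=
    hw.aemeasurable.comp_snd
  have hf' : AEMeasurable (fun z : R3 × R3 => f z.1) (volume.prod volume) :=
    hf.aemeasurable.comp_fst
  have hk : Measurable fun z : R3 × R3 => ‖z.1 - z.2‖ := by fun_prop
  exact (hf'.mul (hw'.pow_const 2)).div hk.aemeasurable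

theorem lintegral_enorm_coulomb_le {f w : R3 → ℝ} (hf : Integrable f)
    (h2 : MemLp w 2 volume) (h4 : MemLp w 4 volume) :
    ∫⁻ z : R3 × R3, ‖f z.1 * w z.2 ^ 2 / ‖z.1 - z.2‖‖ₑ ∂(volume.prod volume)
      ≤ ENNReal.ofReal ((∫ x, |f x|) * potentialBound w) := by
  rw [lintegral_prod _ (aemeasurable_coulomb hf.1 h2.1).enorm]
  calc _ = ∫⁻ x, ∫⁻ y, ‖f x‖ₑ * ENNReal.ofReal (w y ^ 2 / ‖x - y‖) := by
        refine lintegral_congr fun x => lintegral_congr fun y => ?_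
        rw [mul_div_assoc, enorm_mul,
          Real.enorm_eq_ofReal (r := w y ^ 2 / ‖x - y‖) (by positivity)]
    _ = ∫⁻ x, ‖f x‖ₑ * ∫⁻ y, ENNReal.ofReal (w y ^ 2 / ‖x - y‖) := by
        refine lintegral_congr fun x => ?_
        rw [lintegral_const_mul' _ _ enorm_ne_top]
    _ ≤ ∫⁻ x, ‖f x‖ₑ * ENNReal.ofReal (potentialBound w) := by
        refine lintegral_mono fun x => ?_
        gcongr
        exact lintegral_potential_le h2 h4 x
    _ = _ := by
        rw [lintegral_mul_const' _ _ ENNReal.ofReal_ne_top, ENNReal.ofReal_mul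
          (integral_nonneg fun x => abs_nonneg _)]
        congr 1
        simp only [← Real.norm_eq_abs]
        rw [ofReal_integral_norm_eq_lintegral_enorm hf]

theorem integrable_coulomb {f w : R3 → ℝ} (hf : Integrable f)
    (h2 : MemLp w 2 volume) (h4 : MemLp w 4 volume) :
    Integrable (fun z : R3 × R3 => f z.1 * w z.2 ^ 2 / ‖z.1 - z.2‖) (volume.prod volume) := by
  exact ⟨(aemeasurable_coulomb hf.1 h2.1).aestronglyMeasurable,
    (lintegral_enorm_coulomb_le hf h2 h4).trans_lt ENNReal.ofReal_lt_top⟩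

theorem abs_integral_coulomb_le {f w : R3 → ℝ} (hf : Integrable f)
    (h2 : MemLp w 2 volume) (h4 : MemLp w 4 volume) :
    |∫ z : R3 × R3, f z.1 * w z.2 ^ 2 / ‖z.1 - z.2‖ ∂(volume.prod volume)|
      ≤ (∫ x, |f x|) * potentialBound w := by
  refine (abs_integral_le_integral_abs).trans ?_
  simp only [← Real.norm_eq_abs]
  rw [integral_norm_eq_lintegral_enorm (integrable_coulomb hf h2 h4).aestronglyMeasurable]
  refine ENNReal.toReal_le_of_le_ofReal ?_ (lintegral_enorm_coulomb_le hf h2 h4)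
  exact mul_nonneg (integral_nonneg fun x => norm_nonneg _) (potentialBound_nonneg w)

theorem integrable_coulombIntegrand {u : R3 → ℝ} (h2 : MemLp u 2 volume)
    (h4 : MemLp u 4 volume) :
    Integrable (fun z : R3 × R3 => coulombIntegrand u z.1 z.2) (volume.prod volume) :=
  integrable_coulomb h2.integrable_sq h2 h4

theorem integral_abs_mul_le {f g : R3 → ℝ} (hf : MemLp f 2 volume) (hg : MemLp g 2 volume) :
    ∫ x, |f x * g x| ≤ √(∫ x, f x ^ 2) * √(∫ x, g x ^ 2) := by
  have := integral_mul_norm_le_Lp_mul_Lq (μ := (volume : Measure R3)) (f := f) (g := g)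
    Real.HolderConjugate.two_two (by simpa using hf) (by simpa using hg)
  simpa [abs_mul, Real.sqrt_eq_rpow] using this

/-- By symmetry of the kernel the difference equals the Coulomb pairing of `u² - v²` with `u² + v²`.
The potential of the second is bounded, and the first factors as `(u - v)(u + v)`, to which
Cauchy–Schwarz applies. -/
theorem abs_coulomb_sub_le {u v : R3 → ℝ} (hu2 : MemLp u 2 volume) (hu4 : MemLp u 4 volume)
    (hv2 : MemLp v 2 volume) (hv4 : MemLp v 4 volume) :
    |coulomb u - coulomb v| ≤ √(∫ x, (u x - v x) ^ 2) * √(∫ x, (u x + v x) ^ 2)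
      * (potentialBound u + potentialBound v) := by
  set f : R3 → ℝ := fun x => u x ^ 2 - v x ^ 2 with hf
  have hfi : Integrable f := hu2.integrable_sq.sub hv2.integrable_sq
  have hi1 := integrable_coulomb hfi hu2 hu4
  have hi2 := integrable_coulomb hfi hv2 hv4
  have e : coulomb u - coulomb v
      = (∫ z : R3 × R3, f z.1 * u z.2 ^ 2 / ‖z.1 - z.2‖ ∂(volume.prod volume))
      + ∫ z : R3 × R3, f z.1 * v z.2 ^ 2 / ‖z.1 - z.2‖ ∂(volume.prod volume) := by
    rw [← integral_prod_swap (fun z : R3 × R3 => f z.1 * v z.2 ^ 2 / ‖z.1 - z.2‖), coulomb,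
      coulomb, ← integral_sub (integrable_coulombIntegrand hu2 hu4)
        (integrable_coulombIntegrand hv2 hv4), ← integral_add hi1
        (by simpa only [Function.comp_def] using hi2.swap)]
    refine integral_congr_ae (ae_of_all _ fun z => ?_)
    simp only [coulombIntegrand, hf, Prod.fst_swap, Prod.snd_swap, norm_sub_rev z.2 z.1]
    ring
  have hfle : ∫ x, |f x| ≤ √(∫ x, (u x - v x) ^ 2) * √(∫ x, (u x + v x) ^ 2) := by
    refine le_trans (le_of_eq ?_) (integral_abs_mul_le (hu2.sub hv2) (hu2.add hv2))
    refine integral_congr_ae (ae_of_all _ fun x => ?_)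
    simp only [hf]
    congr 1
    ring
  rw [e]
  refine (abs_add_le _ _).trans ((add_le_add (abs_integral_coulomb_le hfi hu2 hu4)
    (abs_integral_coulomb_le hfi hv2 hv4)).trans ?_)
  rw [← mul_add]
  exact mul_le_mul_of_nonneg_right hfle
    (add_nonneg (potentialBound_nonneg u) (potentialBound_nonneg v))

/-! ### Continuity of the power term. -/

theorem rpow_sub_rpow_le {p a b : ℝ} (hp : 1 ≤ p) (hb : 0 ≤ b) (hab : b ≤ a) :
    a ^ p - b ^ p ≤ p * ((a - b) * a ^ (p - 1)) := by
  rcases hb.eq_or_lt with rfl | hb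
  · rcases hab.eq_or_lt with rfl | ha
    · simp
    · rw [Real.zero_rpow (by linarith), sub_zero, sub_zero, ← Real.rpow_one_add' ha.le (by linarith)]
      rw [add_sub_cancel]
      exact le_mul_of_one_le_left (by positivity) hp
  have ha : 0 < a := hb.trans_le hab
  -- Bernoulli's inequality at `b / a` plays the role of the mean value theorem.
  have h := one_add_mul_self_le_rpow_one_add (s := b / a - 1) (p := p)
    (by have : 0 ≤ b / a := by positivity
        linarith) hp
  rw [add_sub_cancel, Real.div_rpow hb.le ha.le, le_div_iff₀ (by positivity)] at h
  have e : a ^ p = a * a ^ (p - 1) := by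
    rw [← Real.rpow_one_add' ha.le (by linarith), add_sub_cancel]
  have e2 : (1 + p * (b / a - 1)) * a ^ p = a ^ p - p * ((a - b) * a ^ (p - 1)) := by
    rw [e]
    field_simp
    ring
  linarith

theorem abs_rpow_sub_rpow_le {p : ℝ} (hp : 1 ≤ p) (a b : ℝ) :
    |(|a| ^ p - |b| ^ p)| ≤ p * |(a - b) * (|a| + |b|) ^ (p - 1)| := by
  have key : ∀ a b : ℝ, |b| ≤ |a| →
      |(|a| ^ p - |b| ^ p)| ≤ p * |(a - b) * (|a| + |b|) ^ (p - 1)| := by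
    intro a b h
    rw [abs_of_nonneg (sub_nonneg.2 (Real.rpow_le_rpow (abs_nonneg _) h (by linarith))), abs_mul,
      abs_of_nonneg (a := (|a| + |b|) ^ (p - 1)) (by positivity)]
    refine (rpow_sub_rpow_le hp (abs_nonneg b) h).trans ?_
    gcongr
    · exact abs_sub_abs_le_abs_sub a b
    · linarith [abs_nonneg b]
  rcases le_total |b| |a| with h | h
  · exact key a b h
  · rw [abs_sub_comm, add_comm, abs_mul, abs_sub_comm a b, ← abs_mul]
    exact key b a h

theorem rpow_le_sq_add_pow_four {s q : ℝ} (hs : 0 ≤ s) (h2 : 2 ≤ q) (h4 : q ≤ 4) :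
    s ^ q ≤ s ^ 2 + s ^ 4 := by
  rcases le_total s 1 with h | h
  · have : s ^ q ≤ s ^ (2 : ℝ) := by
      rcases hs.eq_or_lt with rfl | hs
      · rw [Real.zero_rpow (by linarith), Real.zero_rpow (by norm_num)]
      · exact Real.rpow_le_rpow_of_exponent_ge hs h h2
    rw [Real.rpow_two] at this
    have := pow_nonneg hs 4
    linarith
  · have : s ^ q ≤ s ^ (4 : ℝ) := Real.rpow_le_rpow_of_exponent_le h h4
    rw [show s ^ (4 : ℝ) = s ^ 4 by norm_cast] at this
    have := sq_nonneg s
    linarith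

theorem integrable_abs_rpow {p : ℝ} (h2 : 2 ≤ p) (h4 : p ≤ 4) {u : R3 → ℝ}
    (hu2 : MemLp u 2 volume) (hu4 : MemLp u 4 volume) :
    Integrable (fun x => |u x| ^ p) := by
  have hu : AEMeasurable u := hu2.aestronglyMeasurable.aemeasurable
  refine Integrable.mono' (hu2.integrable_sq.add (integrable_pow_four hu4))
    (AEMeasurable.aestronglyMeasurable (by fun_prop)) (ae_of_all _ fun x => ?_)
  rw [Real.norm_of_nonneg (by positivity)]
  simpa [Even.pow_abs (by decide : Even 4)] using rpow_le_sq_add_pow_four (abs_nonneg (u x)) h2 h4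

/-- Cauchy–Schwarz separates `u - v` from `(|u| + |v|) ^ (p - 1)`. The square of the latter has
exponent `2 (p - 1)` between `2` and `4`, so `L²` and `L⁴` bounds suffice. The `8` comes from `(a +
b)⁴ ≤ 8 (a⁴ + b⁴)`. -/
theorem abs_integral_rpow_sub_le {p : ℝ} (hp2 : 2 ≤ p) (hp3 : p ≤ 3) {u v : R3 → ℝ}
    (hu2 : MemLp u 2 volume) (hu4 : MemLp u 4 volume)
    (hv2 : MemLp v 2 volume) (hv4 : MemLp v 4 volume) :
    |(∫ x, |u x| ^ p) - ∫ x, |v x| ^ p| ≤ p * (√(∫ x, (u x - v x) ^ 2) *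
      √(2 * (∫ x, u x ^ 2) + 2 * (∫ x, v x ^ 2) + 8 * (∫ x, u x ^ 4) + 8 * ∫ x, v x ^ 4)) := by
  have hu : AEMeasurable u := hu2.aestronglyMeasurable.aemeasurable
  have hv : AEMeasurable v := hv2.aestronglyMeasurable.aemeasurable
  set h : R3 → ℝ := fun x => (|u x| + |v x|) ^ (p - 1) with hh
  have hm : AEMeasurable h := by fun_prop
  have hb : ∀ x, h x ^ 2 ≤ 2 * u x ^ 2 + 2 * v x ^ 2 + 8 * u x ^ 4 + 8 * v x ^ 4 := by
    intro x
    have hs : 0 ≤ |u x| + |v x| := by positivity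
    have e : h x ^ 2 = (|u x| + |v x|) ^ ((p - 1) * 2) := by
      rw [Real.rpow_mul hs, Real.rpow_two]
    rw [e]
    refine (rpow_le_sq_add_pow_four hs (by linarith) (by linarith)).trans ?_
    have h1 := add_sq_le (a := |u x|) (b := |v x|)
    have h2 := add_pow_le (abs_nonneg (u x)) (abs_nonneg (v x)) 4
    simp only [sq_abs, Even.pow_abs (by decide : Even 4)] at h1 h2
    norm_num at h2
    linarith
  have hbi : Integrable fun x => 2 * u x ^ 2 + 2 * v x ^ 2 + 8 * u x ^ 4 + 8 * v x ^ 4 :=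
    (((hu2.integrable_sq.const_mul 2).add (hv2.integrable_sq.const_mul 2)).add
      ((integrable_pow_four hu4).const_mul 8)).add ((integrable_pow_four hv4).const_mul 8)
  have hh2 : Integrable fun x => h x ^ 2 :=
    hbi.mono' (hm.pow_const 2).aestronglyMeasurable (ae_of_all _ fun x => by
      rw [Real.norm_of_nonneg (by positivity)]
      exact hb x)
  have hhL : MemLp h 2 volume := (memLp_two_iff_integrable_sq hm.aestronglyMeasurable).2 hh2
  have iu := integrable_abs_rpow hp2 (by linarith) hu2 hu4
  have iv := integrable_abs_rpow hp2 (by linarith) hv2 hv4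
  rw [← integral_sub iu iv]
  calc _ ≤ ∫ x, |(|u x| ^ p - |v x| ^ p)| := abs_integral_le_integral_abs
    _ ≤ ∫ x, p * |(u x - v x) * h x| := by
        refine integral_mono (iu.sub iv).abs ?_ fun x => abs_rpow_sub_rpow_le (by linarith) _ _
        exact (((hu2.sub hv2).integrable_mul hhL).abs).const_mul p
    _ = p * ∫ x, |(u x - v x) * h x| := integral_const_mul _ _
    _ ≤ p * (√(∫ x, (u x - v x) ^ 2) * √(∫ x, h x ^ 2)) := by
        gcongr
        exact integral_abs_mul_le (hu2.sub hv2) hhL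
    _ ≤ _ := by
        gcongr
        refine (integral_mono hh2 hbi hb).trans (le_of_eq ?_)
        have a1 := hu2.integrable_sq.const_mul 2
        have a2 := hv2.integrable_sq.const_mul 2
        have a3 := (integrable_pow_four hu4).const_mul 8
        have a4 := (integrable_pow_four hv4).const_mul 8
        have b1 : Integrable fun x => 2 * u x ^ 2 + 2 * v x ^ 2 := a1.add a2
        have b2 : Integrable fun x => 2 * u x ^ 2 + 2 * v x ^ 2 + 8 * u x ^ 4 := b1.add a3
        rw [integral_add b2 a4, integral_add b1 a3, integral_add a1 a2]
        simp only [integral_const_mul]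

/-! ### Radial cutoffs, mollifiers and convergence of mollifications in `L²`. -/

/-- A function on `ℝ³` depending on the norm only. -/
def IsRadial (u : R3 → ℝ) : Prop := ∀ x y, ‖x‖ = ‖y‖ → u x = u y

/-- A smooth radial cutoff, equal to `1` on the unit ball and supported in the ball of radius `2`. -/
def cutoff (x : R3) : ℝ := Real.smoothTransition (2 - ‖x‖ ^ 2)

theorem contDiff_cutoff : ContDiff ℝ ∞ cutoff :=
  Real.smoothTransition.contDiff.comp (contDiff_const.sub (contDiff_norm_sq ℝ))

theorem cutoff_nonneg (x : R3) : 0 ≤ cutoff x := Real.smoothTransition.nonneg _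

theorem cutoff_le_one (x : R3) : cutoff x ≤ 1 := Real.smoothTransition.le_one _

theorem cutoff_eq_one {x : R3} (hx : ‖x‖ ≤ 1) : cutoff x = 1 :=
  Real.smoothTransition.one_of_one_le (by nlinarith [norm_nonneg x])

theorem cutoff_eq_zero {x : R3} (hx : 2 < ‖x‖) : cutoff x = 0 :=
  Real.smoothTransition.zero_of_nonpos (by nlinarith)

theorem isRadial_cutoff : IsRadial cutoff := fun x y h => by simp [cutoff, h]

theorem hasCompactSupport_of_norm {v : R3 → ℝ} {R : ℝ} (h : ∀ x, R < ‖x‖ → v x = 0) :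
    HasCompactSupport v :=
  HasCompactSupport.intro (isCompact_closedBall (0 : R3) R) fun x hx => h x (by simpa using hx)

/-- The function `cutoff`, rescaled by the factor `r`. -/
def scaledCutoff (r : ℝ) (x : R3) : ℝ := cutoff (r • x)

theorem contDiff_scaledCutoff (r : ℝ) : ContDiff ℝ ∞ (scaledCutoff r) :=
  contDiff_cutoff.comp (contDiff_const_smul r)

theorem scaledCutoff_eq_zero {r : ℝ} (hr : 0 < r) {x : R3} (hx : 2 / r < ‖x‖) :
    scaledCutoff r x = 0 := by
  apply cutoff_eq_zero
  rw [norm_smul, Real.norm_of_nonneg hr.le]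
  rwa [div_lt_iff₀' hr] at hx

theorem hasCompactSupport_scaledCutoff {r : ℝ} (hr : 0 < r) :
    HasCompactSupport (scaledCutoff r) :=
  hasCompactSupport_of_norm fun _ hx => scaledCutoff_eq_zero hr hx

theorem isRadial_scaledCutoff (r : ℝ) : IsRadial (scaledCutoff r) := fun x y h =>
  isRadial_cutoff _ _ (by rw [norm_smul, norm_smul, h])

theorem exists_norm_fderiv_scaledCutoff_le :
    ∃ C : ℝ, 0 ≤ C ∧ ∀ r : ℝ, 0 < r → ∀ x, ‖fderiv ℝ (scaledCutoff r) x‖ ≤ C * r := by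
  have hc : HasCompactSupport cutoff := hasCompactSupport_of_norm fun x hx => cutoff_eq_zero hx
  obtain ⟨C, hC⟩ := (hc.fderiv (𝕜 := ℝ)).exists_bound_of_continuous
    (contDiff_cutoff.continuous_fderiv (by simp))
  refine ⟨C, (norm_nonneg _).trans (hC 0), fun r hr x => ?_⟩
  have h : fderiv ℝ (scaledCutoff r) x = r • fderiv ℝ cutoff (r • x) :=
    fderiv_comp_smul _
  rw [h, norm_smul, Real.norm_of_nonneg hr.le, mul_comm]
  gcongr
  exact hC _

/-- A smooth probability density on `ℝ³` supported in the closed ball of radius `ε`. -/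
structure IsMollifier (η : R3 → ℝ) (ε : ℝ) : Prop where
  contDiff : ContDiff ℝ ∞ η
  nonneg : ∀ x, 0 ≤ η x
  integral_eq_one : ∫ x, η x = 1
  eq_zero : ∀ x, ε < ‖x‖ → η x = 0

theorem exists_radial_mollifier {r : ℝ} (hr : 0 < r) :
    ∃ η, IsMollifier η (2 / r) ∧ IsRadial η := by
  have hpos : 0 < ∫ x, scaledCutoff r x := by
    refine (contDiff_scaledCutoff r).continuous.integral_pos_of_hasCompactSupport_nonneg_nonzero
      (hasCompactSupport_scaledCutoff hr) (fun x => cutoff_nonneg _) (x := 0) ?_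
    simp [scaledCutoff, cutoff_eq_one]
  refine ⟨fun x => (∫ x, scaledCutoff r x)⁻¹ * scaledCutoff r x, ⟨?_, ?_, ?_, ?_⟩, ?_⟩
  · exact contDiff_const.mul (contDiff_scaledCutoff r)
  · exact fun x => mul_nonneg (by positivity) (cutoff_nonneg _)
  · rw [integral_const_mul, inv_mul_cancel₀ hpos.ne']
  · intro x hx
    rw [scaledCutoff_eq_zero hr hx, mul_zero]
  · intro x y h
    simp only [isRadial_scaledCutoff r x y h]

namespace IsMollifier

variable {η : R3 → ℝ} {ε : ℝ}

theorem hasCompactSupport (h : IsMollifier η ε) : HasCompactSupport η :=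
  hasCompactSupport_of_norm h.eq_zero

theorem lintegral_eq_one (h : IsMollifier η ε) : ∫⁻ x, ENNReal.ofReal (η x) = 1 := by
  rw [← ofReal_integral_eq_lintegral_ofReal
    (h.contDiff.continuous.integrable_of_hasCompactSupport h.hasCompactSupport)
    (ae_of_all _ h.nonneg), h.integral_eq_one, ENNReal.ofReal_one]

end IsMollifier

/-- The mollification of `f` by the density `η`. -/
def mollify {F : Type*} [NormedAddCommGroup F] [NormedSpace ℝ F] (η : R3 → ℝ) (f : R3 → F)
    (x : R3) : F :=
  ∫ t, η t • f (x - t)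

section

variable {F : Type*} [NormedAddCommGroup F] [NormedSpace ℝ F]

theorem mollify_eq_convolution (η : R3 → ℝ) (f : R3 → F) :
    mollify η f = convolution f η (ContinuousLinearMap.lsmul ℝ ℝ).flip volume := by
  ext x
  rw [mollify, convolution,
    ← integral_sub_left_eq_self (fun t => η t • f (x - t)) volume x]
  simp

/-- Jensen's inequality for the probability density `a`, obtained from Cauchy–Schwarz by writing `a
= a ^ (1/2) * a ^ (1/2)`. -/
theorem sq_lintegral_mul_le {a b : R3 → ℝ≥0∞} (ha : AEMeasurable a) (hb : AEMeasurable b)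
    (h1 : ∫⁻ t, a t = 1) : (∫⁻ t, a t * b t) ^ 2 ≤ ∫⁻ t, a t * b t ^ 2 := by
  have hr : ∀ c : ℝ≥0∞, c ^ (1 / 2 : ℝ) * c ^ (1 / 2 : ℝ) = c := fun c => by
    rw [← ENNReal.rpow_add_of_nonneg _ _ (by norm_num) (by norm_num)]
    norm_num
  have := ENNReal.lintegral_mul_le_Lp_mul_Lq volume Real.HolderConjugate.two_two
    (f := fun t => a t ^ (1 / 2 : ℝ)) (g := fun t => a t ^ (1 / 2 : ℝ) * b t)
    (ha.pow_const _) ((ha.pow_const _).mul hb)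
  simp only [Pi.mul_apply, ← mul_assoc, hr, ENNReal.rpow_two, sq (_ ^ (1 / 2 : ℝ)), mul_pow,
    h1, ENNReal.one_rpow, one_mul] at this
  calc _ ≤ ((∫⁻ t, a t * b t ^ 2) ^ (1 / 2 : ℝ)) ^ 2 := by gcongr
    _ = _ := by rw [sq, hr]

theorem eLpNorm_two_sq {E : Type*} [NormedAddCommGroup E] (f : R3 → E) :
    eLpNorm f 2 volume ^ 2 = ∫⁻ x, ‖f x‖ₑ ^ 2 := by
  rw [eLpNorm_eq_lintegral_rpow_enorm_toReal (by norm_num) (by norm_num)]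
  rw [← ENNReal.rpow_two, ← ENNReal.rpow_mul]
  simp

/-- The error `mollify η f - f` is the `η`-average of the translation errors `f (x - t) - f x`.
Jensen and Tonelli bound its `L²` norm by the largest of theirs over the support of `η`. -/
theorem eLpNorm_mollify_sub_le [CompleteSpace F] {η : R3 → ℝ} {ε : ℝ} (hη : IsMollifier η ε) {f : R3 → F}
    (hf : MemLp f 2 volume) {δ : ℝ≥0∞}
    (h : ∀ t, ‖t‖ ≤ ε → eLpNorm (fun x => f (x - t) - f x) 2 volume ≤ δ) :
    eLpNorm (fun x => mollify η f x - f x) 2 volume ≤ δ := by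
  have hηi := hη.contDiff.continuous.integrable_of_hasCompactSupport (μ := volume)
    hη.hasCompactSupport
  have hηm : Measurable η := hη.contDiff.continuous.measurable
  have hfm := hf.aestronglyMeasurable
  have hprod : AEStronglyMeasurable (fun z : R3 × R3 => f (z.1 - z.2) - f z.1)
      (volume.prod volume) :=
    (hfm.comp_quasiMeasurePreserving
      (quasiMeasurePreserving_sub_of_right_invariant volume volume)).sub hfm.comp_fst
  have hmeas : ∀ x, AEStronglyMeasurable (fun t => f (x - t) - f x) volume := fun x =>
    (hfm.comp_quasiMeasurePreserving
      (quasiMeasurePreserving_sub_left_of_right_invariant volume x)).sub aestronglyMeasurable_const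
  have hconv : ∀ x, mollify η f x - f x = ∫ t, η t • (f (x - t) - f x) := by
    intro x
    have h1 : Integrable (fun t => η t • f (x - t)) :=
      hη.hasCompactSupport.convolutionExists_left (ContinuousLinearMap.lsmul ℝ ℝ)
        hη.contDiff.continuous (hf.locallyIntegrable (by norm_num)) x
    simp only [smul_sub]
    rw [integral_sub h1 (hηi.smul_const _), integral_smul_const, hη.integral_eq_one, one_smul,
      mollify]
  have key : (eLpNorm (fun x => mollify η f x - f x) 2 volume) ^ 2 ≤ δ ^ 2 := by
    rw [eLpNorm_two_sq]
    calc _ ≤ ∫⁻ x, ∫⁻ t, ENNReal.ofReal (η t) * ‖f (x - t) - f x‖ₑ ^ 2 := by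
          refine lintegral_mono fun x => ?_
          refine le_trans ?_ (sq_lintegral_mul_le hηm.ennreal_ofReal.aemeasurable
            (hmeas x).enorm hη.lintegral_eq_one)
          gcongr
          rw [hconv]
          refine (enorm_integral_le_lintegral_enorm _).trans (le_of_eq ?_)
          refine lintegral_congr fun t => ?_
          rw [enorm_smul, Real.enorm_eq_ofReal (hη.nonneg t)]
      _ = ∫⁻ t, ∫⁻ x, ENNReal.ofReal (η t) * ‖f (x - t) - f x‖ₑ ^ 2 := by
          refine lintegral_lintegral_swap ?_
          simp only [Function.uncurry_def]
          exact (hηm.ennreal_ofReal.comp measurable_snd).aemeasurable.mul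
            (hprod.enorm.pow_const 2)
      _ ≤ ∫⁻ t, ENNReal.ofReal (η t) * δ ^ 2 := by
          refine lintegral_mono fun t => ?_
          rw [lintegral_const_mul' _ _ ENNReal.ofReal_ne_top]
          by_cases ht : ‖t‖ ≤ ε
          · gcongr
            rw [← eLpNorm_two_sq]
            gcongr
            exact h t ht
          · simp [hη.eq_zero t (not_le.1 ht)]
      _ = δ ^ 2 := by
          rw [lintegral_mul_const _ hηm.ennreal_ofReal, hη.lintegral_eq_one, one_mul]
  exact (ENNReal.pow_le_pow_left_iff two_ne_zero).1 key

/-- Translations act continuously on `L²`; the type `DomAddAct` carries this action. -/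
theorem tendsto_eLpNorm_translate_sub {E : Type*} [NormedAddCommGroup E] {f : R3 → E}
    (hf : MemLp f 2 volume) :
    Tendsto (fun t => eLpNorm (fun x => f (x - t) - f x) 2 volume) (𝓝 0) (𝓝 0) := by
  have : Fact ((2 : ℝ≥0∞) ≠ ⊤) := ⟨by norm_num⟩
  have hc : Continuous fun t : R3 => DomAddAct.mk (-t) +ᵥ hf.toLp f := by
    have : Continuous fun t : R3 => DomAddAct.mk (-t) :=
      DomAddAct.continuous_mk.comp continuous_neg
    fun_prop
  have h0 := tendsto_iff_edist_tendsto_0.1 (hc.tendsto 0)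
  refine h0.congr fun t => ?_
  rw [neg_zero, DomAddAct.mk_vadd_toLp, DomAddAct.mk_vadd_toLp, Lp.edist_toLp_toLp]
  refine eLpNorm_congr_ae (ae_of_all _ fun x => ?_)
  simp [sub_eq_neg_add, vadd_eq_add]

theorem tendsto_eLpNorm_mollify_sub [CompleteSpace F] {η : ℕ → R3 → ℝ} {ε : ℕ → ℝ}
    (hη : ∀ n, IsMollifier (η n) (ε n))
    (hε : Tendsto ε atTop (𝓝 0)) {f : R3 → F} (hf : MemLp f 2 volume) :
    Tendsto (fun n => eLpNorm (fun x => mollify (η n) f x - f x) 2 volume) atTop (𝓝 0) := by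
  rw [ENNReal.tendsto_nhds_zero]
  intro δ hδ
  have h := ENNReal.tendsto_nhds_zero.1 (tendsto_eLpNorm_translate_sub hf) δ hδ
  obtain ⟨r, hr, hb⟩ := Metric.eventually_nhds_iff.1 h
  filter_upwards [hε.eventually_lt_const hr] with n hn
  exact eLpNorm_mollify_sub_le (hη n) hf fun t ht => hb (by simpa using ht.trans_lt hn)

theorem contDiff_mollify {η : R3 → ℝ} {ε : ℝ} (hη : IsMollifier η ε) {f : R3 → F}
    (hf : LocallyIntegrable f volume) : ContDiff ℝ ∞ (mollify η f) := by
  rw [mollify_eq_convolution]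
  exact hη.hasCompactSupport.contDiff_convolution_right _ hf hη.contDiff

end

/-! ### Approximation of `H¹` functions by test functions. -/

theorem gradient_apply_eq (v : R3 → ℝ) (x : R3) (i : Fin 3) :
    gradient v x i = fderiv ℝ v x (EuclideanSpace.single i 1) := by
  have h : gradient v x i = inner ℝ (gradient v x) (EuclideanSpace.single i 1) := by
    rw [EuclideanSpace.inner_single_right]
    simp
  rw [h, gradient, InnerProductSpace.toDual_symm_apply]

theorem norm_gradient_eq (v : R3 → ℝ) (x : R3) : ‖gradient v x‖ = ‖fderiv ℝ v x‖ := by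
  simp [gradient]

/-- Mollification commutes with the weak gradient. -/
theorem gradient_mollify {η : R3 → ℝ} {ε : ℝ} (hη : IsMollifier η ε) {u : R3 → ℝ}
    {G : R3 → R3} (hu : MemLp u 2 volume) (hG : HasL2WeakGradient u G) (x : R3) :
    gradient (mollify η u) x = mollify η G x := by
  have hul := hu.locallyIntegrable (by norm_num)
  have hGl := hG.memLp.locallyIntegrable (by norm_num)
  ext i
  set e : R3 := EuclideanSpace.single i 1 with he
  have hη1 : ContDiff ℝ 1 η := hη.contDiff.of_le (by simp)
  rw [gradient_apply_eq, mollify_eq_convolution, mollify_eq_convolution,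
    (hη.hasCompactSupport.hasFDerivAt_convolution_right _ hul hη1 x).fderiv,
    convolution_precompR_apply _ hul (hη.hasCompactSupport.fderiv (𝕜 := ℝ))
      (hη1.continuous_fderiv one_ne_zero)]
  -- The reflected kernel serves as test function in the definition of the weak gradient. The sign
  -- from the inner derivative cancels the sign of integration by parts.
  have hφ : ContDiff ℝ ∞ fun t => η (x - t) := hη.contDiff.comp (contDiff_const.sub contDiff_id)
  have hφc : HasCompactSupport fun t => η (x - t) :=
    hη.hasCompactSupport.comp_homeomorph (Homeomorph.subLeft x)
  have hd : ∀ t, fderiv ℝ (fun t => η (x - t)) t e = - fderiv ℝ η (x - t) e := by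
    intro t
    have h1 : HasFDerivAt (fun t : R3 => x - t) (-ContinuousLinearMap.id ℝ R3) t :=
      (hasFDerivAt_id t).const_sub x
    have h2 := ((hη1.differentiable one_ne_zero (x - t)).hasFDerivAt).comp t h1
    have h3 : fderiv ℝ (fun t => η (x - t)) t = _ := h2.fderiv
    rw [h3]
    simp
  have hw := hG.integral_eq _ hφ hφc i
  rw [← he] at hw
  simp only [hd, mul_neg] at hw
  rw [integral_neg, neg_inj] at hw
  have hint : Integrable fun t => η (x - t) • G t :=
    hGl.integrable_smul_left_of_hasCompactSupport hφ.continuous hφc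
  simp only [convolution, ContinuousLinearMap.flip_apply, ContinuousLinearMap.lsmul_apply,
    smul_eq_mul]
  have hproj : ∫ t, η (x - t) * G t i = (∫ t, η (x - t) • G t) i :=
    (EuclideanSpace.proj (𝕜 := ℝ) i).integral_comp_comm hint
  rw [← hproj]
  simp only [mul_comm (η _), mul_comm (fderiv ℝ η _ _)]
  exact hw

/-- When `‖x‖ = ‖y‖`, the reflection in the hyperplane orthogonal to `x - y` maps `x` to `y`. It
preserves the measure, the kernel and the radial profile of `u`, so it carries one convolution
integral to the other. -/
theorem isRadial_mollify {η : R3 → ℝ} (hη : IsRadial η) {u : R3 → ℝ} {f : ℝ → ℝ}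
    (hu : ∀ᵐ x ∂(volume : Measure R3), u x = f ‖x‖) : IsRadial (mollify η u) := by
  intro x y hxy
  set L : R3 ≃ₗᵢ[ℝ] R3 := (ℝ ∙ (x - y))ᗮ.reflection with hL
  have hLx : L x = y := Submodule.reflection_sub hxy
  have e : mollify η u y = ∫ t, η (L t) • u (y - L t) := by
    rw [mollify, ← L.measurePreserving.integral_comp L.toHomeomorph.measurableEmbedding]
  rw [e, mollify]
  have h1 : ∀ᵐ t ∂(volume : Measure R3), u (x - t) = f ‖x - t‖ :=
    (quasiMeasurePreserving_sub_left_of_right_invariant volume x).ae hu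
  have h2 : ∀ᵐ t ∂(volume : Measure R3), u (y - L t) = f ‖y - L t‖ :=
    L.measurePreserving.quasiMeasurePreserving.ae
      ((quasiMeasurePreserving_sub_left_of_right_invariant volume y).ae hu)
  refine integral_congr_ae ?_
  filter_upwards [h1, h2] with t h1 h2
  rw [h1, h2, hη (L t) t (L.norm_map t), ← hLx, ← map_sub, L.norm_map]

theorem tendsto_eLpNorm_cutoff_sub_one_smul {F : Type*} [NormedAddCommGroup F] [NormedSpace ℝ F]
    {f : R3 → F} (hf : MemLp f 2 volume) :
    Tendsto (fun n : ℕ => eLpNorm (fun x => (scaledCutoff (1 / (n + 1)) x - 1) • f x) 2 volume)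
      atTop (𝓝 0) := by
  have hsq : Tendsto (fun n : ℕ => ∫⁻ x, ‖(scaledCutoff (1 / (n + 1)) x - 1) • f x‖ₑ ^ 2)
      atTop (𝓝 (∫⁻ _ : R3, 0)) := by
    refine tendsto_lintegral_of_dominated_convergence' (fun x => ‖f x‖ₑ ^ 2) (fun n => ?_)
      (fun n => ae_of_all _ fun x => ?_) ?_ (ae_of_all _ fun x => ?_)
    · have := (contDiff_scaledCutoff (1 / ((n : ℝ) + 1))).continuous.aestronglyMeasurable
        (μ := (volume : Measure R3))
      exact ((this.sub aestronglyMeasurable_const).smul hf.1).enorm.pow_const 2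
    · refine pow_le_pow_left' ?_ 2
      rw [enorm_smul]
      refine mul_le_of_le_one_left' ?_
      rw [← enorm_norm, Real.enorm_eq_ofReal (norm_nonneg _), ENNReal.ofReal_le_one,
        Real.norm_eq_abs, abs_le]
      have h0 := cutoff_nonneg ((1 / ((n : ℝ) + 1)) • x)
      have h1 := cutoff_le_one ((1 / ((n : ℝ) + 1)) • x)
      constructor <;> simp only [scaledCutoff] <;> linarith
    · rw [← eLpNorm_two_sq]
      exact ENNReal.pow_ne_top hf.2.ne
    · refine tendsto_const_nhds.congr' ?_
      obtain ⟨N, hN⟩ := exists_nat_ge ‖x‖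
      filter_upwards [eventually_ge_atTop N] with n hn
      have h1 : scaledCutoff (1 / ((n : ℝ) + 1)) x = 1 := by
        refine cutoff_eq_one ?_
        rw [norm_smul, Real.norm_of_nonneg (by positivity), one_div_mul_eq_div,
          div_le_one (by positivity)]
        have : (N : ℝ) ≤ n := by exact_mod_cast hn
        linarith
      rw [h1]
      simp
  rw [lintegral_zero] at hsq
  have := (ENNReal.continuous_rpow_const (y := (1 / 2 : ℝ))).tendsto 0 |>.comp hsq
  rw [ENNReal.zero_rpow_of_pos (by norm_num)] at this
  refine this.congr fun n => ?_
  simp only [Function.comp]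
  rw [← eLpNorm_two_sq, ← ENNReal.rpow_two, ← ENNReal.rpow_mul]
  norm_num

theorem gradient_mul {a b : R3 → ℝ} (ha : ContDiff ℝ ∞ a) (hb : ContDiff ℝ ∞ b) (x : R3) :
    gradient (fun x => a x * b x) x = a x • gradient b x + b x • gradient a x := by
  have h := fderiv_fun_mul (ha.differentiable (by simp) x) (hb.differentiable (by simp) x)
  ext i
  rw [gradient_apply_eq, h, PiLp.add_apply, PiLp.smul_apply, PiLp.smul_apply, gradient_apply_eq,
    gradient_apply_eq]
  simp

theorem continuous_gradient {a : R3 → ℝ} (ha : ContDiff ℝ ∞ a) : Continuous (gradient a) :=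
  (InnerProductSpace.toDual ℝ R3).symm.continuous.comp (ha.continuous_fderiv (by simp))

/-- Smooth compactly supported functions are dense in `H¹`; radial functions are approximated by
radial ones. -/
theorem exists_smooth_approx {u : R3 → ℝ} {G : R3 → R3} (hu : MemLp u 2 volume)
    (hG : HasL2WeakGradient u G) :
    ∃ v : ℕ → R3 → ℝ, (∀ n, ContDiff ℝ ∞ (v n)) ∧ (∀ n, HasCompactSupport (v n)) ∧
      Tendsto (fun n => eLpNorm (fun x => v n x - u x) 2 volume) atTop (𝓝 0) ∧
      Tendsto (fun n => eLpNorm (fun x => gradient (v n) x - G x) 2 volume) atTop (𝓝 0) ∧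
      ((∃ f : ℝ → ℝ, ∀ᵐ x ∂(volume : Measure R3), u x = f ‖x‖) → ∀ n, IsRadial (v n)) := by
  have hpos : ∀ n : ℕ, (0 : ℝ) < n + 1 := fun n => by positivity
  choose η hη hηr using fun n : ℕ => exists_radial_mollifier (hpos n)
  have hε : Tendsto (fun n : ℕ => 2 / ((n : ℝ) + 1)) atTop (𝓝 0) :=
    Tendsto.div_atTop tendsto_const_nhds
      (tendsto_natCast_atTop_atTop.atTop_add tendsto_const_nhds)
  set χ : ℕ → R3 → ℝ := fun n => scaledCutoff (1 / (n + 1)) with hχ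
  have hχpos : ∀ n : ℕ, (0 : ℝ) < 1 / (n + 1) := fun n => by positivity
  have hχs : ∀ n, ContDiff ℝ ∞ (χ n) := fun n => contDiff_scaledCutoff _
  have hχ1 : ∀ n x, ‖χ n x‖ₑ ≤ 1 := fun n x => by
    rw [Real.enorm_eq_ofReal (r := χ n x) (cutoff_nonneg _), ENNReal.ofReal_le_one]
    exact cutoff_le_one _
  have hus : ∀ n, ContDiff ℝ ∞ (mollify (η n) u) := fun n =>
    contDiff_mollify (hη n) (hu.locallyIntegrable (by norm_num))
  have hGm : ∀ n, Continuous (mollify (η n) G) := fun n => by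
    have := (contDiff_mollify (hη n) (hG.memLp.locallyIntegrable (by norm_num))).continuous
    exact this
  have tu := tendsto_eLpNorm_mollify_sub hη hε hu
  have tG := tendsto_eLpNorm_mollify_sub hη hε hG.memLp
  have mono : ∀ {F : Type} [NormedAddCommGroup F] [NormedSpace ℝ F] (n : ℕ) (g : R3 → F),
      eLpNorm (fun x => χ n x • g x) 2 volume ≤ eLpNorm g 2 volume := by
    intro F _ _ n g
    refine eLpNorm_mono_enorm fun x => ?_
    rw [enorm_smul]
    exact mul_le_of_le_one_left' (hχ1 n x)
  refine ⟨fun n x => χ n x * mollify (η n) u x, fun n => (hχs n).mul (hus n),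
    fun n => (hasCompactSupport_scaledCutoff (hχpos n)).mul_right, ?_, ?_, ?_⟩
  · have hlim := tu.add (tendsto_eLpNorm_cutoff_sub_one_smul hu)
    rw [add_zero] at hlim
    refine tendsto_of_tendsto_of_tendsto_of_le_of_le tendsto_const_nhds hlim
      (fun _ => zero_le) fun n => ?_
    have hm1 : AEStronglyMeasurable (fun x => χ n x • (mollify (η n) u x - u x)) volume :=
      (hχs n).continuous.aestronglyMeasurable.smul
        ((hus n).continuous.aestronglyMeasurable.sub hu.1)
    have hm2 : AEStronglyMeasurable (fun x => (χ n x - 1) • u x) volume :=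
      ((hχs n).continuous.aestronglyMeasurable.sub aestronglyMeasurable_const).smul hu.1
    calc _ = eLpNorm ((fun x => χ n x • (mollify (η n) u x - u x))
            + fun x => (χ n x - 1) • u x) 2 volume := by
          congr 1
          ext x
          simp only [Pi.add_apply, smul_eq_mul]
          ring
      _ ≤ _ := (eLpNorm_add_le hm1 hm2 (by norm_num)).trans (by gcongr; exact mono n _)
  -- Besides the two errors already met for `u`, the product rule leaves the mollified function
  -- times the gradient of the cutoff. That gradient is at most `C / (n + 1)`, and the mollified
  -- functions stay bounded in `L²`.
  · obtain ⟨C, hC0, hC⟩ := exists_norm_fderiv_scaledCutoff_le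
    have hsmall : Tendsto (fun n : ℕ => ENNReal.ofReal (C * (1 / (n + 1)))) atTop (𝓝 0) := by
      rw [← ENNReal.ofReal_zero]
      refine ENNReal.tendsto_ofReal ?_
      simpa using tendsto_one_div_add_atTop_nhds_zero_nat.const_mul C
    have hlast : Tendsto (fun n : ℕ => ENNReal.ofReal (C * (1 / (n + 1))) *
        (eLpNorm (fun x => mollify (η n) u x - u x) 2 volume + eLpNorm u 2 volume))
        atTop (𝓝 (0 * (0 + eLpNorm u 2 volume))) :=
      ENNReal.Tendsto.mul hsmall (Or.inr (by simpa using hu.2.ne)) (tu.add tendsto_const_nhds)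
        (Or.inr ENNReal.zero_ne_top)
    rw [zero_mul] at hlast
    have hlim := (tG.add (tendsto_eLpNorm_cutoff_sub_one_smul hG.memLp)).add hlast
    simp only [add_zero] at hlim
    refine tendsto_of_tendsto_of_tendsto_of_le_of_le tendsto_const_nhds hlim
      (fun _ => zero_le) fun n => ?_
    have hm1 : AEStronglyMeasurable (fun x => χ n x • (mollify (η n) G x - G x)) volume :=
      (hχs n).continuous.aestronglyMeasurable.smul
        ((hGm n).aestronglyMeasurable.sub hG.memLp.1)
    have hm2 : AEStronglyMeasurable (fun x => (χ n x - 1) • G x) volume :=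
      ((hχs n).continuous.aestronglyMeasurable.sub aestronglyMeasurable_const).smul hG.memLp.1
    have hm3 : AEStronglyMeasurable (fun x => mollify (η n) u x • gradient (χ n) x) volume :=
      ((hus n).continuous.smul (continuous_gradient (hχs n))).aestronglyMeasurable
    have h3 : eLpNorm (fun x => mollify (η n) u x • gradient (χ n) x) 2 volume ≤
        ENNReal.ofReal (C * (1 / (n + 1))) *
        (eLpNorm (fun x => mollify (η n) u x - u x) 2 volume + eLpNorm u 2 volume) := by
      refine (eLpNorm_le_mul_eLpNorm_of_ae_le_mul (g := mollify (η n) u)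
        (c := C * (1 / (n + 1))) (ae_of_all _ fun x => ?_) 2).trans ?_
      · rw [norm_smul, norm_gradient_eq, mul_comm]
        gcongr
        exact hC _ (hχpos n) x
      · gcongr
        refine le_trans (le_of_eq ?_) (eLpNorm_add_le
          ((hus n).continuous.aestronglyMeasurable.sub hu.1) hu.1 (by norm_num))
        congr 1
        ext x
        simp
    calc _ = eLpNorm (((fun x => χ n x • (mollify (η n) G x - G x))
            + fun x => (χ n x - 1) • G x) + fun x => mollify (η n) u x • gradient (χ n) x)
            2 volume := by
          congr 1
          ext1 x
          rw [gradient_mul (hχs n) (hus n), gradient_mollify (hη n) hu hG]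
          simp only [Pi.add_apply, smul_sub, sub_smul, one_smul]
          abel
      _ ≤ _ := (eLpNorm_add_le (hm1.add hm2) hm3 (by norm_num)).trans (by
          gcongr
          exact (eLpNorm_add_le hm1 hm2 (by norm_num)).trans (by gcongr; exact mono n _))
  · rintro ⟨f, hf⟩ n x y h
    simp only
    rw [isRadial_mollify (hηr n) hf x y h, hχ]
    simp only
    rw [isRadial_scaledCutoff _ x y h]

/-! ### Integrability in `L⁴` and convergence of the energy along approximations. -/

theorem integral_norm_sq_eq {E : Type*} [NormedAddCommGroup E] {f : R3 → E}
    (hf : MemLp f 2 volume) : ∫ x, ‖f x‖ ^ 2 = (eLpNorm f 2 volume).toReal ^ 2 := by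
  rw [← ENNReal.toReal_pow, eLpNorm_two_sq, integral_eq_lintegral_of_nonneg_ae
    (ae_of_all _ fun x => by positivity) (by simpa only [Pi.pow_def] using hf.1.norm.pow 2)]
  congr 1
  refine lintegral_congr fun x => ?_
  rw [ENNReal.ofReal_pow (norm_nonneg _), ofReal_norm]

theorem tendsto_integral_norm_sq {E : Type*} [NormedAddCommGroup E] {f : ℕ → R3 → E} {g : R3 → E}
    (hf : ∀ n, MemLp (f n) 2 volume) (hg : MemLp g 2 volume)
    (h : Tendsto (fun n => eLpNorm (fun x => f n x - g x) 2 volume) atTop (𝓝 0)) :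
    Tendsto (fun n => ∫ x, ‖f n x‖ ^ 2) atTop (𝓝 (∫ x, ‖g x‖ ^ 2)) := by
  have h' := (Lp.tendsto_Lp_iff_tendsto_eLpNorm'' f hf g hg).2 h
  have := h'.norm.pow 2
  simp only [Lp.norm_toLp, ← integral_norm_sq_eq hg] at this
  refine this.congr fun n => ?_
  rw [← integral_norm_sq_eq (hf n)]

theorem tendsto_integral_sub_sq {f : ℕ → R3 → ℝ} {g : R3 → ℝ}
    (hf : ∀ n, MemLp (f n) 2 volume) (hg : MemLp g 2 volume)
    (h : Tendsto (fun n => eLpNorm (fun x => f n x - g x) 2 volume) atTop (𝓝 0)) :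
    Tendsto (fun n => ∫ x, (f n x - g x) ^ 2) atTop (𝓝 0) := by
  have := ((ENNReal.tendsto_toReal ENNReal.zero_ne_top).comp h).pow 2
  simp only [ENNReal.toReal_zero, ne_eq, OfNat.ofNat_ne_zero, not_false_eq_true, zero_pow] at this
  refine this.congr fun n => ?_
  simp only [Function.comp_def]
  have := integral_norm_sq_eq (f := fun x => f n x - g x) ((hf n).sub hg)
  simpa using this.symm

theorem memLp_of_smooth {E : Type*} [NormedAddCommGroup E] {v : R3 → E} (hv : Continuous v)
    (hc : HasCompactSupport v) (q : ℝ≥0∞) : MemLp v q volume :=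
  hv.memLp_of_hasCompactSupport hc

theorem hasCompactSupport_gradient {v : R3 → ℝ} (hc : HasCompactSupport v) :
    HasCompactSupport (gradient v) :=
  (hc.fderiv (𝕜 := ℝ)).comp_left (map_zero _)

/-- Sobolev's inequality bounds the `L⁶` norm by `K` times the `L²` norm of the gradient, and `v⁴ ≤
v² + v⁶`. The right side depends only on quantities that converge under `H¹` approximation. -/
theorem exists_integral_pow_four_le :
    ∃ C : ℝ, 0 ≤ C ∧ ∀ v : R3 → ℝ, ContDiff ℝ ∞ v → HasCompactSupport v →
      ∫ x, v x ^ 4 ≤ (∫ x, v x ^ 2) + C * (∫ x, ‖gradient v x‖ ^ 2) ^ 3 := by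
  set K := SNormLESNormFDerivOfEqConst ℝ (volume : Measure R3) 2
  refine ⟨(K : ℝ) ^ 6, by positivity, fun v hv hc => ?_⟩
  have h := eLpNorm_le_eLpNorm_fderiv_of_eq (volume : Measure R3) (hv.of_le (by simp)) hc
    (p := 2) (p' := 6) (by norm_num) (by simp) (by norm_num)
  have hg2 := memLp_of_smooth (continuous_gradient hv) (hasCompactSupport_gradient hc) 2
  have e2 : eLpNorm (fderiv ℝ v) 2 volume = eLpNorm (gradient v) 2 volume :=
    eLpNorm_congr_norm_ae (ae_of_all _ fun x => (norm_gradient_eq v x).symm)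
  have e6 : ∫ x, v x ^ 6 = (eLpNorm v 6 volume).toReal ^ 6 := by
    have hm : AEStronglyMeasurable (fun x => v x ^ 6) volume :=
      (hv.continuous.pow 6).aestronglyMeasurable
    rw [← ENNReal.toReal_pow, eLpNorm_eq_lintegral_rpow_enorm_toReal (by norm_num) (by norm_num),
      ← ENNReal.rpow_natCast, ← ENNReal.rpow_mul, integral_eq_lintegral_of_nonneg_ae
      (ae_of_all _ fun x => Even.pow_nonneg (by decide) _) hm]
    norm_num
    congr 1
    refine lintegral_congr fun x => ?_
    rw [← ofReal_norm, ← ENNReal.ofReal_pow (norm_nonneg _), Real.norm_eq_abs,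
      Even.pow_abs (by decide)]
  have hreal : (eLpNorm v 6 volume).toReal ≤ K * (eLpNorm (gradient v) 2 volume).toReal := by
    have h' : eLpNorm v 6 volume ≤ K * eLpNorm (gradient v) 2 volume := by
      rw [← e2]
      exact_mod_cast h
    have := ENNReal.toReal_mono (ENNReal.mul_ne_top ENNReal.coe_ne_top hg2.2.ne) h'
    simpa using this
  have i2 : Integrable fun x => v x ^ 2 :=
    (memLp_of_smooth hv.continuous hc 2).integrable_sq
  have i4 := integrable_pow_four (memLp_of_smooth hv.continuous hc 4)
  have i6 : Integrable fun x => v x ^ 6 := by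
    have hv' := hv.continuous
    refine Continuous.integrable_of_hasCompactSupport (by fun_prop) ?_
    exact hc.comp_left (g := fun s : ℝ => s ^ 6) (by norm_num)
  calc ∫ x, v x ^ 4 ≤ ∫ x, (v x ^ 2 + v x ^ 6) := by
        refine integral_mono i4 (i2.add i6) fun x => ?_
        simp only
        nlinarith [mul_nonneg (sq_nonneg (v x)) (sq_nonneg (v x ^ 2 - 1)), sq_nonneg (v x),
          sq_nonneg (v x ^ 3)]
    _ = (∫ x, v x ^ 2) + ∫ x, v x ^ 6 := integral_add i2 i6
    _ ≤ _ := by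
        rw [e6, integral_norm_sq_eq hg2, ← pow_mul, ← mul_pow]
        gcongr

/-- Convergence in `L²` gives an almost everywhere convergent subsequence, and Fatou's lemma
transfers the `L⁴` bound to the limit. -/
theorem memLp_four_of_approx {u : R3 → ℝ} {v : ℕ → R3 → ℝ} {B : ℕ → ℝ} {b : ℝ}
    (hu : MemLp u 2 volume) (hv : ∀ n, Continuous (v n)) (hc : ∀ n, HasCompactSupport (v n))
    (h : Tendsto (fun n => eLpNorm (fun x => v n x - u x) 2 volume) atTop (𝓝 0))
    (hB : ∀ n, ∫ x, v n x ^ 4 ≤ B n) (hb : Tendsto B atTop (𝓝 b)) : MemLp u 4 volume := by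
  have hm : ∀ n, AEStronglyMeasurable (v n) volume := fun n => (hv n).aestronglyMeasurable
  obtain ⟨φ, hφ, hae⟩ := (tendstoInMeasure_of_tendsto_eLpNorm two_ne_zero hm hu.1
    (by simpa only [Pi.sub_def] using h)).exists_seq_tendsto_ae
  have hn : ∀ n, ∫⁻ x, ‖v n x‖ₑ ^ 4 ≤ ENNReal.ofReal (B n) := by
    intro n
    refine le_trans (le_of_eq ?_) (ENNReal.ofReal_le_ofReal (hB n))
    rw [ofReal_integral_eq_lintegral_ofReal (integrable_pow_four (memLp_of_smooth (hv n) (hc n) 4))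
      (ae_of_all _ fun x => Even.pow_nonneg (by decide) _)]
    refine lintegral_congr fun x => ?_
    rw [← ofReal_norm, ← ENNReal.ofReal_pow (norm_nonneg _), Real.norm_eq_abs,
      Even.pow_abs (by decide)]
  have hfin : ∫⁻ x, ‖u x‖ₑ ^ 4 ≤ ENNReal.ofReal b := by
    calc ∫⁻ x, ‖u x‖ₑ ^ 4 = ∫⁻ x, liminf (fun n => ‖v (φ n) x‖ₑ ^ 4) atTop := by
          refine lintegral_congr_ae ?_
          filter_upwards [hae] with x hx
          exact (((ENNReal.continuous_pow 4).tendsto _).comp hx.enorm).liminf_eq.symm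
      _ ≤ liminf (fun n => ∫⁻ x, ‖v (φ n) x‖ₑ ^ 4) atTop :=
          lintegral_liminf_le' fun n => (hm _).enorm.pow_const 4
      _ ≤ liminf (fun n => ENNReal.ofReal (B (φ n))) atTop :=
          liminf_le_liminf (Eventually.of_forall fun n => hn _)
      _ = ENNReal.ofReal b :=
          (ENNReal.tendsto_ofReal (hb.comp hφ.tendsto_atTop)).liminf_eq
  refine ⟨hu.1, ?_⟩
  rw [eLpNorm_lt_top_iff_lintegral_rpow_enorm_lt_top (by norm_num) (by norm_num)]
  refine lt_of_le_of_lt ?_ (hfin.trans_lt ENNReal.ofReal_lt_top)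
  norm_num

theorem hasL2WeakGradient_gradient {v : R3 → ℝ} (hv : ContDiff ℝ ∞ v) (hc : HasCompactSupport v) :
    HasL2WeakGradient v (gradient v) := by
  refine ⟨memLp_of_smooth (continuous_gradient hv) (hasCompactSupport_gradient hc) 2, ?_⟩
  intro φ hφ hφc i
  simp only [gradient_apply_eq]
  have cv := hv.continuous
  have cφ := hφ.continuous
  have dv : Continuous fun x => fderiv ℝ v x (EuclideanSpace.single i 1) :=
    (hv.continuous_fderiv (by simp)).clm_apply continuous_const
  have dφ : Continuous fun x => fderiv ℝ φ x (EuclideanSpace.single i 1) :=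
    (hφ.continuous_fderiv (by simp)).clm_apply continuous_const
  refine integral_mul_fderiv_eq_neg_fderiv_mul_of_integrable ?_ ?_ ?_
    (fun x _ => hv.differentiable (by simp) x) (fun x _ => hφ.differentiable (by simp) x)
  · exact (dv.mul cφ).integrable_of_hasCompactSupport hφc.mul_left
  · exact (cv.mul dφ).integrable_of_hasCompactSupport hc.mul_right
  · exact (cv.mul cφ).integrable_of_hasCompactSupport hc.mul_right

theorem smooth_mem_H1 {v : R3 → ℝ} (hv : ContDiff ℝ ∞ v) (hc : HasCompactSupport v) : v ∈ H1 :=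
  ⟨memLp_of_smooth hv.continuous hc 2, _, hasL2WeakGradient_gradient hv hc⟩

theorem H1.memLp_four {u : R3 → ℝ} (hu : u ∈ H1) : MemLp u 4 volume := by
  obtain ⟨hu2, G, hG⟩ := hu
  obtain ⟨v, hv, hc, h1, h2, -⟩ := exists_smooth_approx hu2 hG
  obtain ⟨C, hC0, hC⟩ := exists_integral_pow_four_le
  have hv2 : ∀ n, MemLp (v n) 2 volume := fun n => memLp_of_smooth (hv n).continuous (hc n) 2
  have t1 := tendsto_integral_norm_sq hv2 hu2 h1
  have t2 := tendsto_integral_norm_sq (fun n => memLp_of_smooth (continuous_gradient (hv n))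
    (hasCompactSupport_gradient (hc n)) 2) hG.memLp h2
  simp only [Real.norm_eq_abs, sq_abs] at t1
  exact memLp_four_of_approx hu2 (fun n => (hv n).continuous) hc h1
    (fun n => hC _ (hv n) (hc n)) (t1.add ((t2.pow 3).const_mul C))

/-- This frees the energy from the chosen weak gradient and from the iterated integral: any
representative may be used, and Fubini applies because `u` is in `L⁴`. -/
theorem energy_eq {u : R3 → ℝ} (hu : u ∈ H1) {G : R3 → R3} (hG : HasL2WeakGradient u G)
    (p lam : ℝ) :
    energy p lam u = (1 / 2) * ((∫ x, ‖G x‖ ^ 2) + ∫ x, u x ^ 2) + (lam / 4) * coulomb u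
      - (1 / p) * ∫ x, |u x| ^ p := by
  have hw := hasL2WeakGradient_weakGradient hu
  have hGi : Integrable fun x => ‖G x‖ ^ 2 := hG.memLp.integrable_norm_pow (by norm_num)
  have hae := hw.ae_eq hG
  have e1 : ∫ x, (‖weakGradient u x‖ ^ 2 + u x ^ 2) = (∫ x, ‖G x‖ ^ 2) + ∫ x, u x ^ 2 := by
    rw [← integral_add hGi hu.1.integrable_sq]
    refine integral_congr_ae ?_
    filter_upwards [hae] with x hx
    rw [hx]
  have e2 : ∫ x, ∫ y, coulombIntegrand u x y = coulomb u :=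
    (integral_prod _ (integrable_coulombIntegrand hu.1 (H1.memLp_four hu))).symm
  rw [energy, e1, e2]

/-- The energy of an `H¹` function is a limit of energies of test functions. -/
theorem exists_smooth_tendsto_energy {p : ℝ} (hp2 : 2 ≤ p) (hp3 : p ≤ 3) {u : R3 → ℝ}
    (hu : u ∈ H1) :
    ∃ v : ℕ → R3 → ℝ, (∀ n, ContDiff ℝ ∞ (v n)) ∧ (∀ n, HasCompactSupport (v n)) ∧
      (∀ lam, Tendsto (fun n => energy p lam (v n)) atTop (𝓝 (energy p lam u))) ∧
      ((∃ f : ℝ → ℝ, ∀ᵐ x ∂(volume : Measure R3), u x = f ‖x‖) → ∀ n, IsRadial (v n)) := by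
  have hu4 := H1.memLp_four hu
  obtain ⟨hu2, G, hG⟩ := id hu
  obtain ⟨v, hv, hc, h1, h2, h3⟩ := exists_smooth_approx hu2 hG
  refine ⟨v, hv, hc, fun lam => ?_, h3⟩
  obtain ⟨C, hC0, hC⟩ := exists_integral_pow_four_le
  have hv2 : ∀ n, MemLp (v n) 2 volume := fun n => memLp_of_smooth (hv n).continuous (hc n) 2
  have hv4 : ∀ n, MemLp (v n) 4 volume := fun n => memLp_of_smooth (hv n).continuous (hc n) 4
  have t0 := tendsto_integral_sub_sq hv2 hu2 h1
  have t1 := tendsto_integral_norm_sq hv2 hu2 h1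
  have t2 := tendsto_integral_norm_sq (fun n => memLp_of_smooth (continuous_gradient (hv n))
    (hasCompactSupport_gradient (hc n)) 2) hG.memLp h2
  simp only [Real.norm_eq_abs, sq_abs] at t1
  have t4 := t1.add ((t2.pow 3).const_mul C)
  have ts : Tendsto (fun n => √(∫ x, (v n x - u x) ^ 2)) atTop (𝓝 0) := by
    simpa [Function.comp_def] using (Real.continuous_sqrt.tendsto _).comp t0
  have tD : Tendsto (fun n => coulomb (v n)) atTop (𝓝 (coulomb u)) := by
    rw [tendsto_iff_norm_sub_tendsto_zero]
    -- Convergence of the fourth-power integrals is not known; they are replaced by their Sobolev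
    -- bounds, which converge. The vanishing first factor then suffices.
    have lim : Tendsto (fun n => √(∫ x, (v n x - u x) ^ 2) *
        √(2 * (∫ x, v n x ^ 2) + 2 * ∫ x, u x ^ 2) * ((∫ x, v n x ^ 2) +
        ((∫ x, v n x ^ 2) + C * (∫ x, ‖gradient (v n) x‖ ^ 2) ^ 3) + sphereArea
          + potentialBound u)) atTop (𝓝 0) := by
      have := (ts.mul ((Real.continuous_sqrt.tendsto _).comp
        ((t1.const_mul 2).add_const (2 * ∫ x, u x ^ 2)))).mul
        (((t1.add t4).add_const sphereArea).add_const (potentialBound u))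
      simpa using this
    refine squeeze_zero (fun n => norm_nonneg _) (fun n => ?_) lim
    refine (abs_coulomb_sub_le (hv2 n) (hv4 n) hu2 hu4).trans ?_
    gcongr
    · exact add_nonneg (potentialBound_nonneg _) (potentialBound_nonneg _)
    · have a1 := (hv2 n).integrable_sq.const_mul 2
      have a2 := hu2.integrable_sq.const_mul 2
      rw [← integral_const_mul, ← integral_const_mul, ← integral_add a1 a2]
      refine integral_mono ((hv2 n).add hu2).integrable_sq (a1.add a2) fun x => ?_
      simp only
      nlinarith [sq_nonneg (v n x - u x)]
    · rw [potentialBound]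
      gcongr
      exact hC _ (hv n) (hc n)
  have tC : Tendsto (fun n => ∫ x, |v n x| ^ p) atTop (𝓝 (∫ x, |u x| ^ p)) := by
    rw [tendsto_iff_norm_sub_tendsto_zero]
    have lim : Tendsto (fun n => p * (√(∫ x, (v n x - u x) ^ 2) *
        √(2 * (∫ x, v n x ^ 2) + 2 * (∫ x, u x ^ 2) +
          8 * ((∫ x, v n x ^ 2) + C * (∫ x, ‖gradient (v n) x‖ ^ 2) ^ 3) + 8 * ∫ x, u x ^ 4)))
        atTop (𝓝 0) := by
      have := (ts.mul ((Real.continuous_sqrt.tendsto _).comp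
        ((((t1.const_mul 2).add_const (2 * ∫ x, u x ^ 2)).add (t4.const_mul 8)).add_const
          (8 * ∫ x, u x ^ 4)))).const_mul p
      simpa using this
    refine squeeze_zero (fun n => norm_nonneg _) (fun n => ?_) lim
    refine (abs_integral_rpow_sub_le hp2 hp3 (hv2 n) (hv4 n) hu2 hu4).trans ?_
    gcongr
    exact hC _ (hv n) (hc n)
  rw [energy_eq hu hG]
  simp only [fun n => energy_eq (smooth_mem_H1 (hv n) (hc n))
    (hasL2WeakGradient_gradient (hv n) (hc n)) p lam]
  exact (((t2.add t1).const_mul _).add (tD.const_mul _)).sub (tC.const_mul _)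

/-! ### The cubic inequality for real integrals and the energy of test functions. -/

/-- The `L³` norm is controlled by the gradient and the Coulomb energy. -/
theorem exists_integral_cube_le :
    ∃ C : ℝ, 0 < C ∧ ∀ v : R3 → ℝ, ContDiff ℝ ∞ v → HasCompactSupport v → ∀ s : ℝ, 0 < s →
      ∫ x, |v x| ^ 3 ≤ C * (s * (∫ x, ‖gradient v x‖ ^ 2) + s⁻¹ * coulomb v) := by
  have hσ := sphereArea_pos
  have hV : 0 < (volume shell).toReal :=
    ENNReal.toReal_pos volume_shell_ne_zero volume_shell_ne_top
  -- The factor `1 + 8 * sphereArea` dominates both coefficients, `1` for the gradient and `8 *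
  -- sphereArea` for the Coulomb energy.
  refine ⟨8 * (1 + 8 * sphereArea) / (volume shell).toReal, by positivity,
    fun v hv hc s hs => ?_⟩
  have h := volume_shell_mul_lintegral_cube_le (hv.of_le (by simp)) hc hs
  have hv2 := memLp_of_smooth hv.continuous hc 2
  have hv4 := memLp_of_smooth hv.continuous hc 4
  have hg2 := memLp_of_smooth (continuous_gradient hv) (hasCompactSupport_gradient hc) 2
  have hci := integrable_coulombIntegrand hv2 hv4
  have hA0 : 0 ≤ ∫ x, ‖gradient v x‖ ^ 2 := integral_nonneg fun x => by positivity
  have hD0 := coulomb_nonneg v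
  have i3 : Integrable fun x => |v x| ^ 3 := by
    have hv' := hv.continuous
    refine Continuous.integrable_of_hasCompactSupport (by fun_prop) ?_
    exact hc.comp_left (g := fun s : ℝ => |s| ^ 3) (by norm_num)
  have e3 : ∫⁻ x, ‖v x‖ₑ ^ 3 = ENNReal.ofReal (∫ x, |v x| ^ 3) := by
    rw [ofReal_integral_eq_lintegral_ofReal i3 (ae_of_all _ fun x => by positivity)]
    refine lintegral_congr fun x => ?_
    rw [← ofReal_norm, ENNReal.ofReal_pow (abs_nonneg _), Real.norm_eq_abs]
  have eA : ∫⁻ x, ‖fderiv ℝ v x‖ₑ ^ 2 = ENNReal.ofReal (∫ x, ‖gradient v x‖ ^ 2) := by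
    rw [ofReal_integral_eq_lintegral_ofReal (hg2.integrable_norm_pow (by norm_num))
      (ae_of_all _ fun x => by positivity)]
    refine lintegral_congr fun x => ?_
    rw [norm_gradient_eq, ENNReal.ofReal_pow (norm_nonneg _), ofReal_norm]
  have eD : ∫⁻ x, ∫⁻ z, ‖v x‖ₑ ^ 2 * ‖v z‖ₑ ^ 2 * ENNReal.ofReal (8 * sphereArea / ‖x - z‖)
      = ENNReal.ofReal (8 * sphereArea * coulomb v) := by
    rw [coulomb, ← integral_const_mul,
      ofReal_integral_eq_lintegral_ofReal (hci.const_mul _) (ae_of_all _ fun z => by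
        simp only [coulombIntegrand, Pi.zero_apply]; positivity),
      lintegral_prod _ (hci.const_mul _).aestronglyMeasurable.aemeasurable.ennreal_ofReal]
    refine lintegral_congr fun x => lintegral_congr fun z => ?_
    rw [← ofReal_norm, ← ofReal_norm, ← ENNReal.ofReal_pow (norm_nonneg _),
      ← ENNReal.ofReal_pow (norm_nonneg _), ← ENNReal.ofReal_mul (by positivity),
      ← ENNReal.ofReal_mul (by positivity), coulombIntegrand]
    simp only [Real.norm_eq_abs, sq_abs]
    congr 1
    ring
  have hs' : 0 < s⁻¹ := inv_pos.2 hs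
  rw [e3, eA, eD, ← ENNReal.ofReal_toReal volume_shell_ne_top, ← ENNReal.ofReal_mul hV.le,
    ← ENNReal.ofReal_mul hs.le, ← ENNReal.ofReal_mul hs'.le, ← ENNReal.ofReal_add (by positivity)
    (by positivity), show (8 : ℝ≥0∞) = ENNReal.ofReal 8 by norm_num,
    ← ENNReal.ofReal_mul (by norm_num), ENNReal.ofReal_le_ofReal_iff (by positivity)] at h
  rw [div_mul_eq_mul_div, le_div_iff₀ hV, mul_comm]
  refine h.trans ?_
  have q1 : 0 ≤ s * (∫ x, ‖gradient v x‖ ^ 2) * sphereArea := by positivity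
  have q2 : 0 ≤ s⁻¹ * coulomb v := by positivity
  linarith [mul_left_comm s⁻¹ (8 * sphereArea) (coulomb v), mul_assoc 8 sphereArea (s⁻¹ * coulomb v),
    mul_comm sphereArea (s * ∫ x, ‖gradient v x‖ ^ 2)]

/-- The squared `H¹` norm of a test function. -/
def sobolevSq (v : R3 → ℝ) : ℝ := (∫ x, ‖gradient v x‖ ^ 2) + ∫ x, v x ^ 2

theorem sobolevSq_nonneg (v : R3 → ℝ) : 0 ≤ sobolevSq v :=
  add_nonneg (integral_nonneg fun x => by positivity) (integral_nonneg fun x => by positivity)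

theorem energy_smooth {v : R3 → ℝ} (hv : ContDiff ℝ ∞ v) (hc : HasCompactSupport v) (p lam : ℝ) :
    energy p lam v = (1 / 2) * sobolevSq v + (lam / 4) * coulomb v - (1 / p) * ∫ x, |v x| ^ p :=
  energy_eq (smooth_mem_H1 hv hc) (hasL2WeakGradient_gradient hv hc) p lam

theorem integrable_abs_cube {v : R3 → ℝ} (hv : ContDiff ℝ ∞ v) (hc : HasCompactSupport v) :
    Integrable fun x => |v x| ^ 3 := by
  have hv' := hv.continuous
  refine Continuous.integrable_of_hasCompactSupport (by fun_prop) ?_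
  exact hc.comp_left (g := fun s : ℝ => |s| ^ 3) (by norm_num)

theorem exists_norm_bound_of_hasCompactSupport {v : R3 → ℝ} (hc : HasCompactSupport v) :
    ∃ R : ℝ, 0 ≤ R ∧ tsupport v ⊆ Metric.closedBall 0 R := by
  obtain ⟨R, hR⟩ := hc.isCompact.isBounded.subset_closedBall (0 : R3)
  exact ⟨max R 0, le_max_right _ _, hR.trans (Metric.closedBall_subset_closedBall (le_max_left _ _))⟩

/-! ### Radial functions: decay and the lower bound of the energy. -/

/-- The radial lemma of Strauss. -/
theorem norm_sq_mul_sq_le_of_isRadial {v : R3 → ℝ} (hv : ContDiff ℝ ∞ v)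
    (hc : HasCompactSupport v) (hr : IsRadial v) (x : R3) :
    ‖x‖ ^ 2 * v x ^ 2 ≤ sobolevSq v / sphereArea := by
  have hσ := sphereArea_pos
  have hv1 : ContDiff ℝ 1 v := hv.of_le (by simp)
  set e : R3 := EuclideanSpace.single 0 1 with he
  have hen : ‖e‖ = 1 := by simp [he]
  set g : ℝ → ℝ := fun s => v (s • e) with hg
  set g' : ℝ → ℝ := fun s => fderiv ℝ v (s • e) e with hg'
  have hder : ∀ (a : R3) (s : ℝ), HasDerivAt (fun s : ℝ => v (s • a)) (fderiv ℝ v (s • a) a) s := by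
    intro a s
    have h1 : HasDerivAt (fun t : ℝ => t • a) a s := by
      simpa using (hasDerivAt_id s).smul_const a
    exact ((hv1.differentiable one_ne_zero _).hasFDerivAt).comp_hasDerivAt s h1
  have hgd : ∀ s, HasDerivAt g (g' s) s := fun s => hder e s
  have hgc : Continuous g := hv.continuous.comp (by fun_prop)
  have hg'c : Continuous g' := by
    have := hv1.continuous_fderiv one_ne_zero
    fun_prop
  have hgx : ∀ y, g ‖y‖ = v y := fun y => hr _ _ (by simp [norm_smul, hen])
  -- The profile `g` is read along `e`, but by radiality it is the same along `y / ‖y‖`, so `g' ‖y‖`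
  -- is a directional derivative of `v` at `y` itself.
  have hg'x : ∀ y : R3, y ≠ 0 → |g' ‖y‖| ≤ ‖gradient v y‖ := by
    intro y hy
    have hy' : 0 < ‖y‖ := norm_pos_iff.2 hy
    set b : R3 := ‖y‖⁻¹ • y with hb
    have hbn : ‖b‖ = 1 := by
      rw [hb, norm_smul, norm_inv, norm_norm, inv_mul_cancel₀ hy'.ne']
    have hgb : g = fun s => v (s • b) := by
      ext s
      exact hr _ _ (by rw [norm_smul, norm_smul, hen, hbn])
    have h1 := hgd ‖y‖
    rw [hgb] at h1
    have h2 := h1.unique (hder b ‖y‖)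
    have h3 : ‖y‖ • b = y := by rw [hb, smul_smul, mul_inv_cancel₀ hy'.ne', one_smul]
    rw [h2, h3, norm_gradient_eq, ← Real.norm_eq_abs]
    simpa [hbn] using (fderiv ℝ v y).le_opNorm b
  set h : ℝ → ℝ := fun s => g s ^ 2 + g' s ^ 2 with hh
  have hhc : Continuous h := (hgc.pow 2).add (hg'c.pow 2)
  have hle : ∀ᵐ y ∂(volume : Measure R3), h ‖y‖ ≤ ‖gradient v y‖ ^ 2 + v y ^ 2 := by
    filter_upwards [compl_mem_ae_iff.2 (measure_singleton (0 : R3))] with y hy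
    have := sq_le_sq' (by linarith [abs_nonneg (g' ‖y‖), hg'x y hy, norm_nonneg (gradient v y)])
      (hg'x y hy)
    rw [sq_abs] at this
    simp only [hh, hgx]
    linarith
  have iN : Integrable fun y => ‖gradient v y‖ ^ 2 + v y ^ 2 :=
    ((memLp_of_smooth (continuous_gradient hv) (hasCompactSupport_gradient hc)
      2).integrable_norm_pow (by norm_num)).add
      (memLp_of_smooth hv.continuous hc 2).integrable_sq
  have hh0 : ∀ s, 0 ≤ h s := fun s => by positivity
  have hint : Integrable fun y : R3 => h ‖y‖ := by
    refine iN.mono' (hhc.comp continuous_norm).aestronglyMeasurable ?_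
    filter_upwards [hle] with y hy
    rwa [Real.norm_of_nonneg (hh0 _)]
  have hint' : IntegrableOn (fun s => s ^ 2 * h s) (Ioi 0) := by
    simpa using (integrable_fun_norm_addHaar (volume : Measure R3)).1 hint
  have hN : sphereArea * ∫ s in Ioi (0 : ℝ), s ^ 2 * h s ≤ sobolevSq v := by
    have e1 : ∫ y : R3, h ‖y‖ = sphereArea * ∫ s in Ioi (0 : ℝ), s ^ 2 * h s := by
      rw [integral_fun_norm_addHaar (volume : Measure R3)]
      simp [sphereArea, mul_assoc]
    rw [← e1, sobolevSq, ← integral_add]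
    · exact integral_mono_ae hint iN hle
    · exact (memLp_of_smooth (continuous_gradient hv) (hasCompactSupport_gradient hc)
        2).integrable_norm_pow (by norm_num)
    · exact (memLp_of_smooth hv.continuous hc 2).integrable_sq
  obtain ⟨R, hR0, hR⟩ := exists_norm_bound_of_hasCompactSupport hc
  set r := ‖x‖ with hr'
  have hr0 : 0 ≤ r := norm_nonneg x
  set T := r + R + 1 with hT
  have hgT : g T = 0 := by
    have : T • e ∉ tsupport v := fun hmem => by
      have := hR hmem
      rw [mem_closedBall_zero_iff, norm_smul, hen, Real.norm_of_nonneg (by positivity)] at this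
      linarith
    exact image_eq_zero_of_notMem_tsupport (f := v) this
  -- This derivative is at least `-s² (g² + g'²)` for `s ≥ 0`. Integrating from `r` to `T`, where
  -- `g` vanishes, bounds `r² g(r)²` by the radial form of the squared `H¹` norm.
  have hd2 : ∀ s, HasDerivAt (fun s => s ^ 2 * g s ^ 2)
      (2 * s * g s ^ 2 + s ^ 2 * (2 * g s * g' s)) s := by
    intro s
    have h1 : HasDerivAt (fun s => s ^ 2 * g s ^ 2) _ s :=
      ((hasDerivAt_id s).pow 2).mul ((hgd s).pow 2)
    refine h1.congr_deriv ?_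
    simp
  have hcd : Continuous fun s => 2 * s * g s ^ 2 + s ^ 2 * (2 * g s * g' s) := by fun_prop
  have hftc := intervalIntegral.integral_eq_sub_of_hasDerivAt (fun s _ => hd2 s)
    (hcd.intervalIntegrable r T)
  rw [hgT] at hftc
  have hrT : r ≤ T := by linarith
  have hsh : Continuous fun s => s ^ 2 * h s := by fun_prop
  have hcmp : ∫ s in r..T, -(s ^ 2 * h s) ≤
      ∫ s in r..T, (2 * s * g s ^ 2 + s ^ 2 * (2 * g s * g' s)) := by
    refine intervalIntegral.integral_mono_on hrT (hsh.neg.intervalIntegrable _ _)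
      (hcd.intervalIntegrable _ _) fun s hs => ?_
    have hs0 : 0 ≤ s := hr0.trans hs.1
    simp only [hh]
    nlinarith [mul_nonneg (sq_nonneg s) (sq_nonneg (g s + g' s)),
      mul_nonneg hs0 (sq_nonneg (g s))]
  rw [intervalIntegral.integral_neg, hftc, intervalIntegral.integral_of_le hrT] at hcmp
  have hmono : ∫ s in Ioc r T, s ^ 2 * h s ≤ ∫ s in Ioi (0 : ℝ), s ^ 2 * h s := by
    refine setIntegral_mono_set hint' (ae_of_all _ fun s => ?_)
      (Eventually.of_forall fun s hs => hr0.trans_lt hs.1)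
    exact mul_nonneg (sq_nonneg s) (hh0 s)
  rw [le_div_iff₀ hσ, ← hgx x]
  have : r ^ 2 * g r ^ 2 ≤ ∫ s in Ioi (0 : ℝ), s ^ 2 * h s := by
    have : T ^ 2 * (0 : ℝ) ^ 2 = 0 := by ring
    linarith
  nlinarith

/-- The Coulomb energy of a function that is large on a set contained in a ball. -/
theorem measure_sq_le_coulomb {v : R3 → ℝ} (hv : ContDiff ℝ ∞ v) (hc : HasCompactSupport v)
    {α ρ : ℝ} (hα : 0 < α) (hρ : 0 ≤ ρ) (hS : ∀ x, α ≤ |v x| → ‖x‖ ≤ ρ) :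
    α ^ 4 * volume.real {x | α ≤ |v x|} ^ 2 ≤ 2 * ρ * coulomb v := by
  set S : Set R3 := {x | α ≤ |v x|} with hSdef
  have hv' := hv.continuous
  have hSm : MeasurableSet S := (isClosed_le continuous_const hv'.abs).measurableSet
  have hSfin : volume S ≠ ⊤ :=
    ((measure_mono fun x hx => mem_closedBall_zero_iff.2 (hS x hx)).trans_lt
      (measure_closedBall_lt_top (x := (0 : R3)) (r := ρ))).ne
  have hci := integrable_coulombIntegrand (memLp_of_smooth hv' hc 2) (memLp_of_smooth hv' hc 4)
  -- On the diagonal the Coulomb integrand is `0` by the convention for division, so the lower bound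
  -- can only hold off this null set.
  have hdiag : ∀ᵐ z ∂((volume : Measure R3).prod volume), z.1 ≠ z.2 := by
    refine (Measure.ae_prod_iff_ae_ae ?_).2 (ae_of_all _ fun x => ?_)
    · exact (measurableSet_eq_fun measurable_fst measurable_snd).compl
    · filter_upwards [compl_mem_ae_iff.2 (measure_singleton x)] with z hz
      exact Ne.symm hz
  have hprod : ∫ z : R3 × R3, (S ×ˢ S).indicator (fun _ => α ^ 4) z ∂(volume.prod volume)
      = α ^ 4 * volume.real S ^ 2 := by
    rw [integral_indicator_const _ (hSm.prod hSm), measureReal_prod_prod, smul_eq_mul]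
    ring
  rw [← hprod, coulomb, ← integral_const_mul]
  refine integral_mono_ae ?_ (hci.const_mul _) ?_
  · refine (integrable_indicator_iff (hSm.prod hSm)).2 (integrableOn_const ?_)
    rw [Measure.prod_prod]
    exact ENNReal.mul_ne_top hSfin hSfin
  · filter_upwards [hdiag] with z hz
    have hpos : 0 < ‖z.1 - z.2‖ := norm_pos_iff.2 (sub_ne_zero.2 hz)
    by_cases hm : z ∈ S ×ˢ S
    · rw [indicator_of_mem hm, coulombIntegrand, mul_div_assoc', le_div_iff₀ hpos]
      obtain ⟨h1, h2⟩ := hm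
      have hn : ‖z.1 - z.2‖ ≤ 2 * ρ := by
        linarith [norm_sub_le z.1 z.2, hS _ h1, hS _ h2]
      have q1 : α ^ 2 ≤ v z.1 ^ 2 := by
        rw [← sq_abs (v z.1)]
        exact pow_le_pow_left₀ hα.le h1 2
      have q2 : α ^ 2 ≤ v z.2 ^ 2 := by
        rw [← sq_abs (v z.2)]
        exact pow_le_pow_left₀ hα.le h2 2
      calc α ^ 4 * ‖z.1 - z.2‖ = (α ^ 2 * α ^ 2) * ‖z.1 - z.2‖ := by ring
        _ ≤ (v z.1 ^ 2 * v z.2 ^ 2) * (2 * ρ) := by gcongr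
        _ = _ := by ring
    · rw [indicator_of_notMem hm]
      unfold coulombIntegrand
      positivity

/-- Below `α` the factor `t ^ (p - 2)` is at most `1 / 2`; above `β` the factor `t ^ (3 - p)` is at
least `1 / c`; in between `t ^ p ≤ β ^ p`. The cubic coefficient can be as small as desired, and the
constant error occurs only where `t ≥ α`. -/
theorem exists_rpow_div_le {p : ℝ} (hp : p ∈ Ioo (2 : ℝ) 3) {c : ℝ} (hc : 0 < c) :
    ∃ α M : ℝ, 0 < α ∧ 0 ≤ M ∧ ∀ t : ℝ, 0 ≤ t →
      (1 / p) * t ^ p ≤ (1 / 4) * t ^ 2 + c * t ^ 3 + (Ici α).indicator (fun _ => M) t := by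
  obtain ⟨hp2, hp3⟩ := hp
  have hp0 : 0 < p := by linarith
  set α : ℝ := (1 / 2) ^ (1 / (p - 2)) with hα
  set β : ℝ := (1 / c) ^ (1 / (3 - p)) with hβ
  have hα0 : 0 < α := by positivity
  have hβ0 : 0 < β := by positivity
  refine ⟨α, β ^ p, hα0, by positivity, fun t ht => ?_⟩
  have hc3 : 0 ≤ c * t ^ 3 := by positivity
  rcases ht.eq_or_lt with rfl | ht0
  · rw [Real.zero_rpow hp0.ne']
    have : 0 ≤ (Ici α).indicator (fun _ => β ^ p) 0 :=
      indicator_nonneg (fun _ _ => by positivity) _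
    simpa using this
  have h1p : 1 / p ≤ 1 / 2 := by gcongr
  have hM : 0 ≤ (Ici α).indicator (fun _ => β ^ p) t :=
    indicator_nonneg (fun _ _ => by positivity) _
  rcases lt_or_ge t α with h | h
  · have e : t ^ p = t ^ (p - 2) * t ^ 2 := by
      rw [← Real.rpow_two, ← Real.rpow_add ht0, sub_add_cancel]
    have h2 : t ^ (p - 2) ≤ 1 / 2 := by
      refine (Real.rpow_le_rpow ht h.le (by linarith)).trans (le_of_eq ?_)
      rw [hα, ← Real.rpow_mul (by norm_num), one_div_mul_cancel (by linarith), Real.rpow_one]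
    have : (1 / p) * t ^ p ≤ (1 / 2) * ((1 / 2) * t ^ 2) := by
      rw [e]
      gcongr
    linarith
  · have h1 : (1 / p) * t ^ p ≤ t ^ p := by
      have : 0 ≤ t ^ p := by positivity
      nlinarith
    have ht2 := sq_nonneg t
    rcases le_or_gt t β with h' | h'
    · rw [indicator_of_mem (mem_Ici.2 h)]
      have := Real.rpow_le_rpow ht h' hp0.le
      linarith
    · have e : t ^ (3 - p) * t ^ p = t ^ 3 := by
        rw [← Real.rpow_add ht0, sub_add_cancel]
        norm_cast
      have h2 : 1 / c ≤ t ^ (3 - p) := by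
        refine le_trans (le_of_eq ?_) (Real.rpow_le_rpow hβ0.le h'.le (by linarith))
        rw [hβ, ← Real.rpow_mul (by positivity), one_div_mul_cancel (by linarith), Real.rpow_one]
      have h3 : t ^ p ≤ c * t ^ 3 := by
        rw [← e, ← mul_assoc]
        refine le_mul_of_one_le_left (by positivity) ?_
        rwa [div_le_iff₀' hc] at h2
      linarith

theorem exists_energy_lower_bound_radial {p : ℝ} (hp : p ∈ Ioo (2 : ℝ) 3) {lam : ℝ}
    (hlam : 0 < lam) :
    ∃ m : ℝ, ∀ v : R3 → ℝ, ContDiff ℝ ∞ v → HasCompactSupport v → IsRadial v →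
      m ≤ energy p lam v := by
  have hσ := sphereArea_pos
  obtain ⟨C, hC0, hC⟩ := exists_integral_cube_le
  -- With this `c` the cubic term costs at most `A / 4 + (lam / 8) D`, which leaves another `(lam /
  -- 8) D` for the set `S`.
  set c : ℝ := min (1 / 4) (lam / 8) / C with hcdef
  have hmin : 0 < min (1 / 4) (lam / 8) := by positivity
  have hc0 : 0 < c := by positivity
  obtain ⟨α, M, hα, hM, hαM⟩ := exists_rpow_div_le hp hc0
  set κ : ℝ := 4 * M ^ 2 / (lam * α ^ 4) * (√(1 / sphereArea) / α) with hκ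
  refine ⟨-κ ^ 2, fun v hv hc hr => ?_⟩
  have hv' := hv.continuous
  set N := sobolevSq v with hN
  have hN0 : 0 ≤ N := sobolevSq_nonneg v
  set D := coulomb v with hD
  have hD0 : 0 ≤ D := coulomb_nonneg v
  set S : Set R3 := {x | α ≤ |v x|} with hSdef
  have hSm : MeasurableSet S := (isClosed_le continuous_const hv'.abs).measurableSet
  -- Strauss decay shows that `|v x| ≥ α` forces `‖x‖ ≤ ρ`.
  set ρ : ℝ := √N * (√(1 / sphereArea) / α) with hρdef
  have hρ0 : 0 ≤ ρ := by positivity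
  have hSρ : ∀ x, α ≤ |v x| → ‖x‖ ≤ ρ := by
    intro x hx
    have h1 := norm_sq_mul_sq_le_of_isRadial hv hc hr x
    have h2 : (‖x‖ * α) ^ 2 ≤ N * (1 / sphereArea) := by
      rw [mul_one_div]
      refine le_trans ?_ h1
      rw [mul_pow, ← sq_abs (v x)]
      gcongr
    have h3 := Real.le_sqrt_of_sq_le h2
    rw [Real.sqrt_mul hN0] at h3
    rw [hρdef, mul_div_assoc', le_div_iff₀ hα]
    exact h3
  have hcoul := measure_sq_le_coulomb hv hc hα hρ0 hSρ
  rw [← hSdef, ← hD] at hcoul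
  set a := volume.real S with ha
  have ha0 : 0 ≤ a := measureReal_nonneg
  have hSfin : volume S ≠ ⊤ :=
    ((measure_mono fun x hx => mem_closedBall_zero_iff.2 (hSρ x hx)).trans_lt
      (measure_closedBall_lt_top (x := (0 : R3)) (r := ρ))).ne
  have iM : Integrable (S.indicator fun _ => M) volume :=
    (integrable_indicator_iff hSm).2 (integrableOn_const hSfin)
  have i2 := (memLp_of_smooth hv' hc 2).integrable_sq
  have i3 := integrable_abs_cube hv hc
  have ip := integrable_abs_rpow hp.1.le (by linarith [hp.2]) (memLp_of_smooth hv' hc 2)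
    (memLp_of_smooth hv' hc 4)
  have hpt : (1 / p) * ∫ x, |v x| ^ p ≤
      (1 / 4) * (∫ x, v x ^ 2) + c * (∫ x, |v x| ^ 3) + M * a := by
    have j1 : Integrable fun x => (1 / 4) * v x ^ 2 + c * |v x| ^ 3 :=
      (i2.const_mul _).add (i3.const_mul _)
    have e : (1 / 4) * (∫ x, v x ^ 2) + c * (∫ x, |v x| ^ 3) + M * a =
        ∫ x, ((1 / 4) * v x ^ 2 + c * |v x| ^ 3 + S.indicator (fun _ => M) x) := by
      rw [integral_add j1 iM, integral_add (i2.const_mul _) (i3.const_mul _), integral_const_mul,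
        integral_const_mul, integral_indicator_const _ hSm, smul_eq_mul, mul_comm M]
    rw [e, ← integral_const_mul]
    refine integral_mono (ip.const_mul _) (j1.add iM) fun x => ?_
    have := hαM |v x| (abs_nonneg _)
    rw [sq_abs] at this
    exact this
  have hcube : c * (∫ x, |v x| ^ 3) ≤ (1 / 4) * (∫ x, ‖gradient v x‖ ^ 2) + (lam / 8) * D := by
    have h1 := hC v hv hc 1 one_pos
    have hA0 : 0 ≤ ∫ x, ‖gradient v x‖ ^ 2 := integral_nonneg fun x => by positivity
    have hcC : c * C = min (1 / 4) (lam / 8) := div_mul_cancel₀ _ hC0.ne'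
    calc c * (∫ x, |v x| ^ 3) ≤ c * (C * (1 * (∫ x, ‖gradient v x‖ ^ 2) + 1⁻¹ * coulomb v)) := by
          gcongr
      _ = min (1 / 4) (lam / 8) * (∫ x, ‖gradient v x‖ ^ 2) + min (1 / 4) (lam / 8) * D := by
          rw [← mul_assoc, hcC]
          ring
      _ ≤ _ := by
          gcongr
          · exact min_le_left _ _
          · exact min_le_right _ _
  -- Young's inequality against `D ≥ α⁴ a² / (2 ρ)`, made explicit by completing the square. The
  -- case `ρ = 0` is separate because of the division; there `a = 0`.
  have hMa : M * a ≤ (lam / 8) * D + 4 * M ^ 2 / (lam * α ^ 4) * ρ := by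
    rcases hρ0.eq_or_lt with h0 | hpos
    · rw [← h0] at hcoul
      have ha2 : a = 0 := by
        have : a ^ 2 ≤ 0 := by
          by_contra hcon
          have : 0 < α ^ 4 * a ^ 2 := mul_pos (by positivity) (not_le.1 hcon)
          linarith
        exact pow_eq_zero_iff two_ne_zero |>.1 (le_antisymm this (sq_nonneg a))
      rw [ha2, ← h0]
      simp only [mul_zero, add_zero]
      positivity
    · have hDl : α ^ 4 * a ^ 2 / (2 * ρ) ≤ D := by
        rw [div_le_iff₀ (by positivity)]
        linarith
      have hsq : M * a ≤ (lam / 8) * (α ^ 4 * a ^ 2 / (2 * ρ))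
          + 4 * M ^ 2 / (lam * α ^ 4) * ρ := by
        have e : (lam / 8) * (α ^ 4 * a ^ 2 / (2 * ρ)) + 4 * M ^ 2 / (lam * α ^ 4) * ρ - M * a
            = (lam * α ^ 4 * a - 8 * M * ρ) ^ 2 / (16 * ρ * (lam * α ^ 4)) := by
          field_simp
          ring
        have : 0 ≤ (lam * α ^ 4 * a - 8 * M * ρ) ^ 2 / (16 * ρ * (lam * α ^ 4)) := by positivity
        linarith
      have := mul_le_mul_of_nonneg_left hDl (by positivity : 0 ≤ lam / 8)
      linarith
  have hκρ : 4 * M ^ 2 / (lam * α ^ 4) * ρ = κ * √N := by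
    rw [hκ, hρdef]
    ring
  -- The difference of the two sides is `(√N / 2 - κ)²`.
  have hfin : -κ ^ 2 ≤ (1 / 4) * N - κ * √N := by
    nlinarith [sq_nonneg (√N / 2 - κ), Real.sq_sqrt hN0]
  rw [energy_smooth hv hc, ← hN, ← hD]
  have hNe : N = (∫ x, ‖gradient v x‖ ^ 2) + ∫ x, v x ^ 2 := rfl
  rw [hκρ] at hMa
  linarith

/-! ### Sign of the energy and the effect of a negative value. -/

theorem exists_energy_nonneg_smooth {p : ℝ} (hp2 : 2 ≤ p) (hp3 : p ≤ 3) :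
    ∃ lam : ℝ, ∀ v : R3 → ℝ, ContDiff ℝ ∞ v → HasCompactSupport v → 0 ≤ energy p lam v := by
  obtain ⟨C, hC0, hC⟩ := exists_integral_cube_le
  -- With `s = C⁻¹` the cubic integral is at most `A + C² D`. Half of this is exactly matched by `A
  -- / 2` and `(lam / 4) D` for `lam = 2 C²`.
  refine ⟨2 * C ^ 2, fun v hv hc => ?_⟩
  have hv' := hv.continuous
  have i2 := (memLp_of_smooth hv' hc 2).integrable_sq
  have i3 := integrable_abs_cube hv hc
  have ip := integrable_abs_rpow hp2 (by linarith) (memLp_of_smooth hv' hc 2)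
    (memLp_of_smooth hv' hc 4)
  have hpt : ∀ t : ℝ, 0 ≤ t → t ^ p ≤ t ^ 2 + t ^ 3 := by
    intro t ht
    have h3 : t ^ (3 : ℝ) = t ^ 3 := by norm_cast
    rcases ht.eq_or_lt with rfl | ht0
    · rw [Real.zero_rpow (by linarith)]; norm_num
    rcases le_total t 1 with h | h
    · have := Real.rpow_le_rpow_of_exponent_ge ht0 h hp2
      rw [Real.rpow_two] at this
      have := pow_nonneg ht 3
      linarith
    · have := Real.rpow_le_rpow_of_exponent_le h hp3
      rw [h3] at this
      have := sq_nonneg t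
      linarith
  have hI : ∫ x, |v x| ^ p ≤ (∫ x, v x ^ 2) + ∫ x, |v x| ^ 3 := by
    rw [← integral_add i2 i3]
    refine integral_mono ip (i2.add i3) fun x => ?_
    have := hpt |v x| (abs_nonneg _)
    rwa [sq_abs] at this
  have h0 : 0 ≤ ∫ x, |v x| ^ p := integral_nonneg fun x => by positivity
  have h1p : (1 / p) * (∫ x, |v x| ^ p) ≤ (1 / 2) * ∫ x, |v x| ^ p := by gcongr
  have hL := hC v hv hc C⁻¹ (by positivity)
  rw [inv_inv, mul_add, ← mul_assoc, mul_inv_cancel₀ hC0.ne', ← mul_assoc] at hL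
  rw [energy_smooth hv hc, sobolevSq]
  nlinarith

/-- Two distant copies of a test function of negative energy have even lower energy. -/
theorem exists_energy_le_of_neg {p lam : ℝ} (hp2 : 2 ≤ p) (hp3 : p ≤ 3) {v : R3 → ℝ}
    (hv : ContDiff ℝ ∞ v) (hc : HasCompactSupport v) (hneg : energy p lam v < 0) :
    ∃ w : R3 → ℝ, ContDiff ℝ ∞ w ∧ HasCompactSupport w ∧
      energy p lam w ≤ (3 / 2) * energy p lam v := by
  have hp0 : 0 < p := by linarith
  obtain ⟨R, hR0, hR⟩ := exists_norm_bound_of_hasCompactSupport hc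
  set B := ∫ x, v x ^ 2 with hB
  -- `K` is the gap between the two supports. The two cross terms of the Coulomb energy are at most
  -- `B² / K` each, so they contribute at most `|lam| B² / (2 K)`, which is at most half of the
  -- negated energy. The `1` keeps `K` positive when `lam` or `B` vanishes.
  set K : ℝ := (|lam| * B ^ 2 + 1) / (-energy p lam v) with hK
  have hK0 : 0 < K := div_pos (by positivity) (by linarith)
  set y : R3 := EuclideanSpace.single 0 (2 * R + K) with hy
  have hyn : ‖y‖ = 2 * R + K := by
    rw [hy, PiLp.norm_single, Real.norm_of_nonneg (by positivity)]
  set vy : R3 → ℝ := fun x => v (x - y) with hvy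
  have hvys : ContDiff ℝ ∞ vy := hv.comp (contDiff_id.sub contDiff_const)
  have hvyc : HasCompactSupport vy := hc.comp_homeomorph (Homeomorph.subRight y)
  have hgvy : ∀ x, gradient vy x = gradient v (x - y) := fun x => by
    have : fderiv ℝ vy x = fderiv ℝ v (x - y) := fderiv_comp_sub y
    rw [gradient, gradient, this]
  have hnear : ∀ x, x ∈ tsupport v → ‖x‖ ≤ R := fun x hx => by simpa using hR hx
  have hdisj : ∀ x, x ∉ tsupport v ∨ x - y ∉ tsupport v := by
    intro x
    by_contra! h
    have h1 := hnear _ h.1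
    have h2 := hnear _ h.2
    have h3 : ‖y‖ ≤ ‖x‖ + ‖x - y‖ := by
      have := norm_sub_le x (x - y)
      rwa [sub_sub_cancel] at this
    linarith
  have hvy0 : ∀ x, x - y ∉ tsupport v → vy x = 0 := fun x hx =>
    image_eq_zero_of_notMem_tsupport (f := v) hx
  have hg0 : ∀ x, x ∉ tsupport v → gradient v x = 0 := fun x hx => by
    have h1 : fderiv ℝ v x = 0 :=
      image_eq_zero_of_notMem_tsupport fun h => hx (tsupport_fderiv_subset ℝ h)
    rw [gradient, h1, map_zero]
  have hws : ContDiff ℝ ∞ fun x => v x + vy x := hv.add hvys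
  have hwc : HasCompactSupport fun x => v x + vy x := hc.add hvyc
  refine ⟨fun x => v x + vy x, hws, hwc, ?_⟩
  have hv2 := memLp_of_smooth hv.continuous hc 2
  have hv4 := memLp_of_smooth hv.continuous hc 4
  have hvy2 := memLp_of_smooth hvys.continuous hvyc 2
  have hvy4 := memLp_of_smooth hvys.continuous hvyc 4
  have hsq : ∀ x, (v x + vy x) ^ 2 = v x ^ 2 + vy x ^ 2 := by
    intro x
    rcases hdisj x with h | h
    · rw [image_eq_zero_of_notMem_tsupport h]; ring
    · rw [hvy0 x h]; ring
  have eB : ∫ x, (v x + vy x) ^ 2 = 2 * B := by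
    simp only [hsq]
    rw [integral_add hv2.integrable_sq hvy2.integrable_sq, hvy,
      integral_sub_right_eq_self (fun x => v x ^ 2) y, two_mul]
  have eA : ∫ x, ‖gradient (fun x => v x + vy x) x‖ ^ 2 = 2 * ∫ x, ‖gradient v x‖ ^ 2 := by
    have hga : ∀ x, gradient (fun x => v x + vy x) x = gradient v x + gradient vy x := fun x => by
      have : fderiv ℝ (fun x => v x + vy x) x = fderiv ℝ v x + fderiv ℝ vy x :=
        fderiv_fun_add (hv.differentiable (by simp) x) (hvys.differentiable (by simp) x)
      rw [gradient, this, map_add]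
      rfl
    have e : ∀ x, ‖gradient (fun x => v x + vy x) x‖ ^ 2
        = ‖gradient v x‖ ^ 2 + ‖gradient v (x - y)‖ ^ 2 := by
      intro x
      rw [hga, hgvy]
      rcases hdisj x with h | h
      · rw [hg0 x h]; simp
      · rw [hg0 _ h]; simp
    have ig : Integrable fun x => ‖gradient v x‖ ^ 2 :=
      (memLp_of_smooth (continuous_gradient hv) (hasCompactSupport_gradient hc)
        2).integrable_norm_pow (by norm_num)
    simp only [e]
    rw [integral_add ig (ig.comp_sub_right y),
      integral_sub_right_eq_self (fun x => ‖gradient v x‖ ^ 2) y, two_mul]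
  have eC : ∫ x, |v x + vy x| ^ p = 2 * ∫ x, |v x| ^ p := by
    have e : ∀ x, |v x + vy x| ^ p = |v x| ^ p + |v (x - y)| ^ p := by
      intro x
      rcases hdisj x with h | h
      · rw [image_eq_zero_of_notMem_tsupport h]
        simp [hp0.ne', hvy]
      · rw [hvy0 x h,
          image_eq_zero_of_notMem_tsupport h]
        simp [hp0.ne']
    have ip := integrable_abs_rpow hp2 (by linarith) hv2 hv4
    simp only [e]
    rw [integral_add ip (ip.comp_sub_right y),
      integral_sub_right_eq_self (fun x => |v x| ^ p) y, two_mul]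
  have eD : |coulomb (fun x => v x + vy x) - 2 * coulomb v| ≤ 2 * (B ^ 2 / K) := by
    set cr : R3 × R3 → ℝ := fun z => v z.1 ^ 2 * vy z.2 ^ 2 / ‖z.1 - z.2‖ with hcr
    have icr : Integrable cr (volume.prod volume) := integrable_coulomb hv2.integrable_sq hvy2 hvy4
    have iv := integrable_coulombIntegrand hv2 hv4
    have ivy := integrable_coulombIntegrand hvy2 hvy4
    have hvyD : coulomb vy = coulomb v :=
      calc coulomb vy = ∫ z : R3 × R3, (fun z : R3 × R3 => coulombIntegrand v z.1 z.2) (z - (y, y))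
            ∂(volume.prod volume) := by
            refine integral_congr_ae (ae_of_all _ fun z => ?_)
            simp [coulombIntegrand, hvy]
        _ = coulomb v := integral_sub_right_eq_self (μ := volume.prod volume)
            (fun z : R3 × R3 => coulombIntegrand v z.1 z.2) (y, y)
    have hsplit : coulomb (fun x => v x + vy x)
        = coulomb v + coulomb vy + ((∫ z, cr z ∂(volume.prod volume))
          + ∫ z, cr z.swap ∂(volume.prod volume)) := by
      have icr' : Integrable (fun z => cr z.swap) (volume.prod volume) := icr.swap
      have j1 : Integrable (fun z : R3 × R3 => coulombIntegrand v z.1 z.2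
          + coulombIntegrand vy z.1 z.2) (volume.prod volume) := iv.add ivy
      have j2 : Integrable (fun z : R3 × R3 => cr z + cr z.swap) (volume.prod volume) :=
        icr.add icr'
      rw [coulomb, coulomb, coulomb, ← integral_add iv ivy, ← integral_add icr icr',
        ← integral_add j1 j2]
      refine integral_congr_ae (ae_of_all _ fun z => ?_)
      simp only [coulombIntegrand, hsq, hcr, Prod.fst_swap, Prod.snd_swap, norm_sub_rev z.2 z.1]
      ring
    have hcr0 : 0 ≤ ∫ z, cr z ∂(volume.prod volume) :=
      integral_nonneg fun z => by simp only [hcr, Pi.zero_apply]; positivity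
    have hcrK : ∫ z, cr z ∂(volume.prod volume) ≤ B ^ 2 / K := by
      have ivv : Integrable (fun z : R3 × R3 => v z.1 ^ 2 * vy z.2 ^ 2) (volume.prod volume) :=
        hv2.integrable_sq.mul_prod hvy2.integrable_sq
      have hval : ∫ z : R3 × R3, (v z.1 ^ 2 * vy z.2 ^ 2) / K ∂(volume.prod volume) = B ^ 2 / K := by
        rw [integral_div, integral_prod_mul (fun x => v x ^ 2) (fun x => vy x ^ 2), hvy,
          integral_sub_right_eq_self (fun x => v x ^ 2) y, sq]
      rw [← hval]
      refine integral_mono icr (ivv.div_const K) fun z => ?_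
      simp only [hcr]
      by_cases h1 : z.1 ∈ tsupport v
      · by_cases h2 : z.2 - y ∈ tsupport v
        · have n1 := hnear _ h1
          have n2 := hnear _ h2
          have n3 : K ≤ ‖z.1 - z.2‖ := by
            have e : y = (z.1 - (z.2 - y)) - (z.1 - z.2) := by abel
            have q1 := norm_sub_le (z.1 - (z.2 - y)) (z.1 - z.2)
            rw [← e] at q1
            linarith [norm_sub_le z.1 (z.2 - y)]
          gcongr
        · simp [hvy0 z.2 h2]
      · simp [image_eq_zero_of_notMem_tsupport h1]
    have hsw : ∫ z : R3 × R3, cr z.swap ∂(volume.prod volume) = ∫ z, cr z ∂(volume.prod volume) :=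
      integral_prod_swap cr
    rw [hsplit, hvyD, hsw, abs_le]
    constructor <;> linarith
  have hlamD : (lam / 4) * coulomb (fun x => v x + vy x) ≤
      (lam / 4) * (2 * coulomb v) + (|lam| / 4) * (2 * (B ^ 2 / K)) := by
    have h1 : (lam / 4) * (coulomb (fun x => v x + vy x) - 2 * coulomb v)
        ≤ |lam / 4| * |coulomb (fun x => v x + vy x) - 2 * coulomb v| := by
      rw [← abs_mul]
      exact le_abs_self _
    have h2 : |lam / 4| * |coulomb (fun x => v x + vy x) - 2 * coulomb v|
        ≤ |lam / 4| * (2 * (B ^ 2 / K)) := by gcongr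
    rw [abs_div, abs_of_pos (by norm_num : (0 : ℝ) < 4)] at h1 h2
    linarith
  have hsmall : |lam| * (B ^ 2 / K) ≤ -energy p lam v := by
    rw [mul_div_assoc', div_le_iff₀ hK0, hK, mul_div_cancel₀ _ (by linarith)]
    linarith
  have hEv := energy_smooth hv hc p lam
  have hEw := energy_smooth hws hwc p lam
  rw [sobolevSq, eA, eB, eC] at hEw
  rw [sobolevSq, ← hB] at hEv
  rw [hEw]
  linarith

/-- Scaling a fixed bump by `t` multiplies the quadratic part by `t²` and the power term by `t ^ p`,
and `p > 2`. -/
theorem exists_energy_zero_neg {p : ℝ} (hp2 : 2 < p) :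
    ∃ v : R3 → ℝ, ContDiff ℝ ∞ v ∧ HasCompactSupport v ∧ energy p 0 v < 0 := by
  have hp0 : 0 < p := by linarith
  have hc : HasCompactSupport cutoff := hasCompactSupport_of_norm fun x hx => cutoff_eq_zero hx
  set I := ∫ x, |cutoff x| ^ p with hI
  have hIpos : 0 < I := by
    refine Continuous.integral_pos_of_hasCompactSupport_nonneg_nonzero (x := 0)
      (contDiff_cutoff.continuous.abs.rpow_const fun x => Or.inr hp0.le) ?_
      (fun x => by positivity) ?_
    · exact hc.comp_left (g := fun s : ℝ => |s| ^ p) (by simp [hp0.ne'])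
    · simp [cutoff_eq_one]
  set N := sobolevSq cutoff with hN
  have ht : Tendsto (fun t : ℝ => t ^ (p - 2)) atTop atTop := tendsto_rpow_atTop (by linarith)
  obtain ⟨t, ht1, ht0⟩ :=
    ((ht.eventually_gt_atTop (p * N / (2 * I))).and (eventually_gt_atTop 0)).exists
  have hs : ContDiff ℝ ∞ fun x => t * cutoff x := contDiff_const.mul contDiff_cutoff
  have hsc : HasCompactSupport fun x => t * cutoff x := hc.mul_left
  refine ⟨fun x => t * cutoff x, hs, hsc, ?_⟩
  have hg : ∀ x, gradient (fun x => t * cutoff x) x = t • gradient cutoff x := fun x => by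
    have : fderiv ℝ (fun x => t * cutoff x) x = t • fderiv ℝ cutoff x :=
      fderiv_const_mul (contDiff_cutoff.differentiable (by simp) x) t
    rw [gradient, this, map_smulₛₗ]
    rfl
  have eN : sobolevSq (fun x => t * cutoff x) = t ^ 2 * N := by
    rw [hN, sobolevSq, sobolevSq, mul_add, ← integral_const_mul, ← integral_const_mul]
    congr 1
    · refine integral_congr_ae (ae_of_all _ fun x => ?_)
      simp only [hg, norm_smul, mul_pow, Real.norm_eq_abs, sq_abs]
    · refine integral_congr_ae (ae_of_all _ fun x => ?_)
      simp only [mul_pow]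
  have eI : ∫ x, |t * cutoff x| ^ p = t ^ p * I := by
    rw [hI, ← integral_const_mul]
    refine integral_congr_ae (ae_of_all _ fun x => ?_)
    simp only [abs_mul]
    rw [Real.mul_rpow (abs_nonneg _) (abs_nonneg _), abs_of_pos ht0]
  rw [energy_smooth hs hsc, eN, eI]
  have et : t ^ p = t ^ (p - 2) * t ^ 2 := by
    rw [← Real.rpow_two, ← Real.rpow_add ht0, sub_add_cancel]
  rw [div_lt_iff₀ (by positivity)] at ht1
  have h1 : (1 / 2) * N < (1 / p) * (t ^ (p - 2) * I) := by
    rw [one_div_mul_eq_div, one_div_mul_eq_div, div_lt_div_iff₀ (by norm_num) hp0]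
    linarith
  have h2 := mul_lt_mul_of_pos_left h1 (by positivity : 0 < t ^ 2)
  rw [et]
  linarith

/-- A negative value persists at a nearby test function. Each passage to two distant copies
multiplies the bound on the energy by at least `3 / 2`, so it falls below every real number. -/
theorem iInf_energy_eq_bot {p lam : ℝ} (hp2 : 2 ≤ p) (hp3 : p ≤ 3) {u : R3 → ℝ} (hu : u ∈ H1)
    (hneg : energy p lam u < 0) : (⨅ u ∈ H1, ((energy p lam u : ℝ) : EReal)) = ⊥ := by
  obtain ⟨v, hv, hc, hlim, -⟩ := exists_smooth_tendsto_energy hp2 hp3 hu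
  obtain ⟨n, hn⟩ := ((hlim lam).eventually_lt_const hneg).exists
  have hiter : ∀ k : ℕ, ∃ w : R3 → ℝ, ContDiff ℝ ∞ w ∧ HasCompactSupport w ∧
      energy p lam w ≤ (3 / 2) ^ k * energy p lam (v n) := by
    intro k
    induction k with
    | zero => exact ⟨v n, hv n, hc n, by simp⟩
    | succ k ih =>
      obtain ⟨w, hw, hwc, hle⟩ := ih
      have hw0 : energy p lam w < 0 := hle.trans_lt (mul_neg_of_pos_of_neg (by positivity) hn)
      obtain ⟨w', hw', hwc', hle'⟩ := exists_energy_le_of_neg hp2 hp3 hw hwc hw0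
      refine ⟨w', hw', hwc', hle'.trans ?_⟩
      rw [pow_succ]
      linarith
  rw [EReal.eq_bot_iff_forall_lt]
  intro b
  have ht : Tendsto (fun k : ℕ => (3 / 2 : ℝ) ^ k * energy p lam (v n)) atTop atBot :=
    (tendsto_pow_atTop_atTop_of_one_lt (by norm_num)).atTop_mul_const_of_neg hn
  obtain ⟨k, hk⟩ := (ht.eventually_lt_atBot b).exists
  obtain ⟨w, hw, hwc, hle⟩ := hiter k
  refine lt_of_le_of_lt (iInf₂_le w (smooth_mem_H1 hw hwc)) ?_
  exact_mod_cast hle.trans_lt hk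

theorem energy_sub_energy {u : R3 → ℝ} (hu : u ∈ H1) (p lam lam' : ℝ) :
    energy p lam u - energy p lam' u = (lam - lam') / 4 * coulomb u := by
  rw [energy_eq hu (hasL2WeakGradient_weakGradient hu) p lam,
    energy_eq hu (hasL2WeakGradient_weakGradient hu) p lam']
  ring

end SchrodingerPoissonSlater

end

open SchrodingerPoissonSlater MeasureTheory in
/-- The first conjunct says that all integrals in the energy converge on `H¹(ℝ³)`; the infimum is
taken in the extended reals. -/
theorem theorem1p6 (p : ℝ) (hp : p ∈ Set.Ioo (2 : ℝ) 3) :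
    (∀ u ∈ H1,
      Integrable (fun x => ‖weakGradient u x‖ ^ 2 + u x ^ 2) volume ∧
      Integrable (fun z : R3 × R3 => coulombIntegrand u z.1 z.2) (volume.prod volume) ∧
      Integrable (fun x => |u x| ^ p) volume) ∧
    (∃ lam₀ : ℝ, 0 < lam₀ ∧
      (∀ lam : ℝ, lam₀ ≤ lam → (⨅ u ∈ H1, ((energy p lam u : ℝ) : EReal)) = 0) ∧
      (∀ lam : ℝ, lam < lam₀ → (⨅ u ∈ H1, ((energy p lam u : ℝ) : EReal)) = ⊥)) ∧
    (∀ lam : ℝ, 0 < lam → BddBelow (energy p lam '' H1rad)) := by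
  have hp2 := hp.1.le
  have hp3 := hp.2.le
  refine ⟨fun u hu => ⟨?_, integrable_coulombIntegrand hu.1 (H1.memLp_four hu),
    integrable_abs_rpow hp2 (by linarith) hu.1 (H1.memLp_four hu)⟩, ?_, fun lam hlam => ?_⟩
  · exact ((hasL2WeakGradient_weakGradient hu).memLp.integrable_norm_pow (by norm_num)).add
      hu.1.integrable_sq
  -- The threshold is `sInf Λ`: monotonicity in `lam` makes `Λ` upward closed, and `0 ∉ Λ` makes all
  -- its elements positive.
  · set Λ : Set ℝ := {lam | ∀ u ∈ H1, 0 ≤ energy p lam u} with hΛ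
    have hup : ∀ lam ∈ Λ, ∀ lam', lam ≤ lam' → lam' ∈ Λ := by
      intro lam h lam' hle u hu
      have h1 := energy_sub_energy hu p lam' lam
      have h2 : 0 ≤ (lam' - lam) / 4 * coulomb u :=
        mul_nonneg (by linarith) (coulomb_nonneg u)
      linarith [h u hu]
    have h0 : (0 : ℝ) ∉ Λ := by
      intro h
      obtain ⟨v, hv, hc, hlt⟩ := exists_energy_zero_neg hp.1
      exact absurd (h v (smooth_mem_H1 hv hc)) (not_le.2 hlt)
    have hne : Λ.Nonempty := by
      obtain ⟨lam, hlam⟩ := exists_energy_nonneg_smooth hp2 hp3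
      refine ⟨lam, fun u hu => ?_⟩
      obtain ⟨v, hv, hc, hlim, -⟩ := exists_smooth_tendsto_energy hp2 hp3 hu
      exact ge_of_tendsto' (hlim lam) fun n => hlam _ (hv n) (hc n)
    have hpos : ∀ lam ∈ Λ, 0 < lam := fun lam h => by
      by_contra hle
      exact h0 (hup lam h 0 (not_lt.1 hle))
    have hbdd : BddBelow Λ := ⟨0, fun lam h => (hpos lam h).le⟩
    -- For each `u` the condition on `lam` is closed, since the energy is affine in `lam`. The
    -- infimum therefore belongs to `Λ`, which gives both `sInf Λ > 0` and the case `lam = sInf Λ`.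
    have hmem : sInf Λ ∈ Λ := by
      intro u hu
      have hcl : IsClosed {lam | 0 ≤ energy p lam u} := by
        refine isClosed_le continuous_const ?_
        simp only [energy_eq hu (hasL2WeakGradient_weakGradient hu) p]
        fun_prop
      have hsub : Λ ⊆ {lam | 0 ≤ energy p lam u} := fun lam h => h u hu
      exact hcl.closure_subset_iff.2 hsub (csInf_mem_closure hne hbdd)
    refine ⟨sInf Λ, hpos _ hmem, fun lam hle => le_antisymm ?_ ?_, fun lam hlt => ?_⟩
    · have hz : ContDiff ℝ (⊤ : ℕ∞) (fun _ : R3 => (0 : ℝ)) := contDiff_const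
      have hzc : HasCompactSupport (fun _ : R3 => (0 : ℝ)) := HasCompactSupport.zero
      refine (iInf₂_le _ (smooth_mem_H1 hz hzc)).trans ?_
      have hp0 : p ≠ 0 := by linarith
      have hg : gradient (fun _ : R3 => (0 : ℝ)) = 0 := by
        ext1 x
        simp [gradient]
      rw [energy_smooth hz hzc, sobolevSq, coulomb, hg]
      simp [coulombIntegrand, hp0]
    · refine le_iInf₂ fun u hu => ?_
      exact_mod_cast hup _ hmem lam hle u hu
    · have : lam ∉ Λ := notMem_of_lt_csInf hlt hbdd
      simp only [hΛ, Set.mem_ofPred_eq, not_forall, not_le] at this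
      obtain ⟨u, hu, hneg⟩ := this
      exact iInf_energy_eq_bot hp2 hp3 hu hneg
  · obtain ⟨m, hm⟩ := exists_energy_lower_bound_radial hp hlam
    refine ⟨m, ?_⟩
    rintro _ ⟨u, ⟨hu, hrad⟩, rfl⟩
    obtain ⟨v, hv, hc, hlim, hvr⟩ := exists_smooth_tendsto_energy hp2 hp3 hu
    exact ge_of_tendsto' (hlim lam) fun n => hm _ (hv n) (hc n) (hvr hrad n)
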